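/- All structures are finite, may have an empty domain, are considered up to isomorphism, and have a finite relational signature. Monadic second-order logic ($\mathrm{MSO}$) is the extension of first-order logic by quantification over sets of elements. \emph{Transductions.} For $k\ge 2$, $\mathrm{copy}_k(\mathfrak A)$ is the disjoint union of $k$ copies of $\mathfrak A$, expanded by the binary relation $\sim$ with $\langle a,i\rangle\sim\langle b,j\rangle$ iff $a=b$ and by the unary predicates $P_i=\{\langle a,i\rangle : a\in A\}$ for $i<k$; $\mathrm{copy}_1(\mathfrak A)=\mathfrak A$. The many-valued operation $\mathrm{exp}_m$ maps $\mathfrak A$ to all its expansions by $m$ unary predicates $Q_0,\dots,Q_{m-1}\subseteq A$. A basic $\mathrm{MSO}$-transduction $\tau_0$ is given by $\mathrm{MSO}$-formulae $\chi$, $\delta(x)$ and $\varphi_R(\bar x)$, one $\varphi_R$ for each output relation symbol $R$. If $\mathfrak A\models\chi$, then $\tau_0(\mathfrak A)$ is the structure with domain $D=\{a\in A:\mathfrak A\models\delta(a)\}$ and relations $\{\bar a\in D^{\mathrm{ar}(R)}:\mathfrak A\models\varphi_R(\bar a)\}$; otherwise $\tau_0(\mathfrak A)$ is undefined. A transduction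 is an operation $\tau=\tau_0\circ\mathrm{copy}_k\circ\mathrm{exp}_m$ with $k\ge1$, $m\ge0$; $\tau(\mathfrak A)$ is the set of its possible values and $\tau(\mathcal K)=\bigcup_{\mathfrak A\in\mathcal K}\tau(\mathfrak A)$. \emph{Incidence structures.} For $\mathfrak A=\langle A,R_0,\dots,R_{s-1}\rangle$ with maximal arity $r$, let $E=R_0\cup\dots\cup R_{s-1}$ be the set of all tuples in relations of $\mathfrak A$. The incidence structure is $$\mathfrak A_{\mathrm{in}}=\langle A\sqcup E,P_{R_0},\dots,P_{R_{s-1}},\mathrm{in}_0,\dots,\mathrm{in}_{r-1}\rangle,$$ where $P_{R_i}=\{\bar c\in E:\bar c\in R_i\}$ and $\mathrm{in}_i=\{(a,\bar c)\in A\times E: |\bar c|>i,\ a=c_i\}$. For a class $\mathcal C$ of structures over one signature let $\mathcal C_{\mathrm{in}}=\{\mathfrak A_{\mathrm{in}}:\mathfrak A\in\mathcal C\}$. Write $\mathcal C\sqsubseteq_{\mathrm{in}}\mathcal K$ if $\mathcal C_{\mathrm{in}}\subseteq\tau(\mathcal K_{\mathrm{in}})$ for some transduction $\tau$, and $\mathcal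 C\sqsubset_{\mathrm{in}}\mathcal K$ if $\mathcal C\sqsubseteq_{\mathrm{in}}\mathcal K$ and $\mathcal K\not\sqsubseteq_{\mathrm{in}}\mathcal C$. \emph{Trees and paths.} For $n\in\mathbb N$ let $\mathcal T_n=\{m^{<n}: m\in\mathbb N\}$, where $m^{<n}$ is the complete $m$-ary tree of height $n$, regarded as the structure $\langle V,\mathrm{edg}\rangle$ whose vertices are the sequences of length less than $n$ over $\{0,\dots,m-1\}$ and in which $(x,y)\in\mathrm{edg}$ iff $y=xd$ for some $d<m$. Let $\mathcal P$ be the class of all finite nonempty undirected paths, regarded as structures $\langle V,\mathrm{edg}\rangle$ with symmetric edge relation. \textbf{Statement.} Let $\mathcal C$ be a class of structures over a finite relational signature. (1) If $\mathcal T_n\sqsubseteq_{\mathrm{in}}\mathcal C$ for all $n\in\mathbb N$, then $\mathcal P\sqsubseteq_{\mathrm{in}}\mathcal C$. (2) If $\mathcal C\sqsubset_{\mathrm{in}}\mathcal P$, then there is some $n\in\mathbb N$ such that $\mathcal C\sqsubseteq_{\mathrm{in}}\mathcal T_n$. -/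

import Mathlib

namespace MSOTransduction

open scoped FirstOrder

/-- A finite structure over a relational signature (possibly with empty domain). -/
structure FinStr (L : FirstOrder.Language.{0, 0}) [L.IsRelational] where
  carrier : Type
  [finite : Finite carrier]
  [str : L.Structure carrier]

attribute [instance] FinStr.finite FinStr.str

/-- Build a finite structure from the interpretation of the relation symbols alone. -/
def FinStr.ofRel (L : FirstOrder.Language.{0, 0}) [L.IsRelational] (A : Type) [Finite A]
    (r : ∀ n, L.Relations n → (Fin n → A) → Prop) : FinStr L where
  carrier := A
  str := { funMap := fun f _ => isEmptyElim f, RelMap := fun {n} R a => r n R a }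

/-! ### Monadic second-order logic -/

/-- MSO-formulae over the relation symbols of `L` with free set variables `X₀, …, X_{n-1}`.
All variables are set variables; elements are represented by singleton sets. -/
inductive MSO (L : FirstOrder.Language.{0, 0}) : ℕ → Type
  /-- `X_i ⊆ X_j` -/
  | sub {n : ℕ} (i j : Fin n) : MSO L n
  /-- `R Z₀ … Z_{k-1}`: some tuple `a ∈ R` has `a_i ∈ Z_i` for all `i`. -/
  | rel {n k : ℕ} (R : L.Relations k) (Z : Fin k → Fin n) : MSO L n
  | neg {n : ℕ} (φ : MSO L n) : MSO L n
  | and {n : ℕ} (φ ψ : MSO L n) : MSO L n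
  /-- `∃ X_n, φ(X₀, …, X_n)` -/
  | ex {n : ℕ} (φ : MSO L (n + 1)) : MSO L n

/-- Satisfaction of an MSO-formula under an assignment of sets to its free variables. -/
def MSO.Realize {L : FirstOrder.Language.{0, 0}} {A : Type} [L.Structure A] :
    {n : ℕ} → MSO L n → (Fin n → Set A) → Prop
  | _, .sub i j, V => V i ⊆ V j
  | _, .rel R Z, V => ∃ a, (∀ i, a i ∈ V (Z i)) ∧ FirstOrder.Language.Structure.RelMap R a
  | _, .neg φ, V => ¬ φ.Realize V
  | _, .and φ ψ, V => φ.Realize V ∧ ψ.Realize V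
  | _, .ex φ, V => ∃ X : Set A, φ.Realize (Fin.snoc (α := fun _ => Set A) V X)

/-- `A ⊨ φ(a₀, …, a_{n-1})` for elements `a_i`, each element being read as a singleton. -/
def MSO.RealizeAt {L : FirstOrder.Language.{0, 0}} {A : Type} [L.Structure A] {n : ℕ}
    (φ : MSO L n) (a : Fin n → A) : Prop :=
  φ.Realize fun i => {a i}

/-! ### Transductions -/

/-- The symbols added by `exp_m`: unary predicates `Q₀, …, Q_{m-1}`. -/
inductive ExpRel (m : ℕ) : ℕ → Type
  | param (i : Fin m) : ExpRel m 1

/-- The symbols added by `copy_k`: a binary `∼` and unary `P₀, …, P_{k-1}` if `k ≥ 2`,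
and no symbols if `k = 1`. -/
inductive CopyRel (k : ℕ) : ℕ → Type
  | sim (h : 2 ≤ k) : CopyRel k 2
  | part (h : 2 ≤ k) (i : Fin k) : CopyRel k 1

def expLang (L : FirstOrder.Language.{0, 0}) (m : ℕ) : FirstOrder.Language.{0, 0} :=
  ⟨fun _ => Empty, fun n => L.Relations n ⊕ ExpRel m n⟩

def copyLang (L : FirstOrder.Language.{0, 0}) (k : ℕ) : FirstOrder.Language.{0, 0} :=
  ⟨fun _ => Empty, fun n => L.Relations n ⊕ CopyRel k n⟩

instance (L : FirstOrder.Language.{0, 0}) (m : ℕ) : (expLang L m).IsRelational :=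
  fun _ => inferInstanceAs (IsEmpty Empty)

instance (L : FirstOrder.Language.{0, 0}) (k : ℕ) : (copyLang L k).IsRelational :=
  fun _ => inferInstanceAs (IsEmpty Empty)

section

variable {L L' : FirstOrder.Language.{0, 0}} [L.IsRelational] [L'.IsRelational]

/-- The expansion of `A` by the unary predicates `Q₀, …, Q_{m-1}`. -/
def FinStr.exp {m : ℕ} (A : FinStr L) (Q : Fin m → Set A.carrier) : FinStr (expLang L m) :=
  .ofRel _ A.carrier fun
    | _, .inl R, a => FirstOrder.Language.Structure.RelMap R a
    | _, .inr (.param i), a => a 0 ∈ Q i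

/-- `copy_k(A)`: the disjoint union of `k` copies of `A`, where `(a, i)` is the `i`-th copy of `a`,
expanded (if `k ≥ 2`) by `(a, i) ∼ (b, j) ↔ a = b` and by `P_i`, the `i`-th copy. -/
def FinStr.copy (k : ℕ) (A : FinStr L) : FinStr (copyLang L k) :=
  .ofRel _ (A.carrier × Fin k) fun
    | _, .inl R, a =>
        ∃ i, (∀ j, (a j).2 = i) ∧ FirstOrder.Language.Structure.RelMap R fun j => (a j).1
    | _, .inr (.sim _), a => (a 0).1 = (a 1).1
    | _, .inr (.part _ i), a => (a 0).2 = i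

variable (L L') in
/-- The definition scheme `⟨χ, δ(x), (φ_R(x̄))_R⟩` of a basic MSO-transduction. -/
structure Basic where
  χ : MSO L 0
  δ : MSO L 1
  φ : ∀ {n : ℕ}, L'.Relations n → MSO L n

/-- The partial operation defined by a scheme is defined at `A` if `A ⊨ χ`. -/
def Basic.DefinedAt (σ : Basic L L') (A : FinStr L) : Prop :=
  σ.χ.RealizeAt (A := A.carrier) Fin.elim0

/-- The value of a basic transduction at `A` (meaningful only where it is defined). -/
def Basic.output (σ : Basic L L') (A : FinStr L) : FinStr L' :=
  .ofRel _ {a : A.carrier // σ.δ.RealizeAt ![a]} fun _ R a =>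
    (σ.φ R).RealizeAt fun i => (a i : A.carrier)

variable (L L') in
/-- A `k`-copying MSO-transduction `τ₀ ∘ copy_k ∘ exp_m`. -/
structure Transduction where
  k : ℕ
  one_le_k : 1 ≤ k
  m : ℕ
  base : Basic (copyLang (expLang L m) k) L'

/-- `B ∈ τ(A)`, structures being considered up to isomorphism. -/
def Transduction.Maps (τ : Transduction L L') (A : FinStr L) (B : FinStr L') : Prop :=
  ∃ Q : Fin τ.m → Set A.carrier,
    τ.base.DefinedAt ((A.exp Q).copy τ.k) ∧
    Nonempty (B.carrier ≃[L'] (τ.base.output ((A.exp Q).copy τ.k)).carrier)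

/-- `τ(K) = ⋃ {τ(A) | A ∈ K}`. -/
def Transduction.image (τ : Transduction L L') (K : Set (FinStr L)) : Set (FinStr L') :=
  {B | ∃ A ∈ K, τ.Maps A B}

/-- `C ⊑ K`: there is a transduction `τ` with `C ⊆ τ(K)`. -/
def Below (C : Set (FinStr L')) (K : Set (FinStr L)) : Prop :=
  ∃ τ : Transduction L L', C ⊆ τ.image K

end

/-! ### Incidence structures -/

/-- The signature of incidence structures: `P_R` for every relation symbol `R`, and `in_i` for
every `i` smaller than the maximal arity. -/
inductive IncRel (L : FirstOrder.Language.{0, 0}) : ℕ → Type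
  | P {n : ℕ} (R : L.Relations n) : IncRel L 1
  | inc (i : ℕ) (h : ∃ n, i < n ∧ Nonempty (L.Relations n)) : IncRel L 2

def incLang (L : FirstOrder.Language.{0, 0}) : FirstOrder.Language.{0, 0} := ⟨fun _ => Empty, IncRel L⟩

instance (L : FirstOrder.Language.{0, 0}) : (incLang L).IsRelational :=
  fun _ => inferInstanceAs (IsEmpty Empty)

section

variable {L L' : FirstOrder.Language.{0, 0}} [L.IsRelational] [L'.IsRelational]

/-- The set `E` of all tuples that belong to some relation of `A`. -/
def FinStr.Tuples (A : FinStr L) : Type :=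
  {c : Σ n, Fin n → A.carrier // ∃ R : L.Relations c.1, FirstOrder.Language.Structure.RelMap R c.2}

instance [Finite L.Symbols] (A : FinStr L) : Finite A.Tuples := by
  have : Finite (Σ n, L.Relations n) :=
    Finite.of_injective (Sum.inr : _ → L.Symbols) Sum.inr_injective
  let f : {p : Σ R : (Σ n, L.Relations n), Fin R.1 → A.carrier //
      FirstOrder.Language.Structure.RelMap p.1.2 p.2} → A.Tuples :=
    fun p => ⟨⟨p.1.1.1, p.1.2⟩, p.1.1.2, p.2⟩
  refine Finite.of_surjective f ?_
  rintro ⟨⟨n, c⟩, R, h⟩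
  exact ⟨⟨⟨⟨n, R⟩, c⟩, h⟩, rfl⟩

/-- The incidence structure `A_in` with domain `A ⊔ E`. -/
def FinStr.incidence [Finite L.Symbols] (A : FinStr L) : FinStr (incLang L) :=
  .ofRel _ (A.carrier ⊕ A.Tuples) fun
    | _, .P (n := n) R, x => ∃ c : A.Tuples, x 0 = .inr c ∧
        ∃ a : Fin n → A.carrier, c.1 = ⟨n, a⟩ ∧ FirstOrder.Language.Structure.RelMap R a
    | _, .inc i _, x => ∃ (a : A.carrier) (c : A.Tuples), x 0 = .inl a ∧ x 1 = .inr c ∧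
        ∃ h : i < c.1.1, a = c.1.2 ⟨i, h⟩

/-- `C ⊑_in K`: `C_in ⊑ K_in`, where `C_in = {A_in | A ∈ C}`. -/
def BelowIn [Finite L.Symbols] [Finite L'.Symbols]
    (C : Set (FinStr L)) (K : Set (FinStr L')) : Prop :=
  Below (FinStr.incidence '' C) (FinStr.incidence '' K)

/-- `C ⊏_in K`: `C ⊑_in K` but not `K ⊑_in C`. -/
def StrictlyBelowIn [Finite L.Symbols] [Finite L'.Symbols]
    (C : Set (FinStr L)) (K : Set (FinStr L')) : Prop :=
  BelowIn C K ∧ ¬ BelowIn K C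

end

/-! ### Trees and paths -/

/-- The signature with a single binary relation symbol has finitely many symbols. -/
instance : Finite FirstOrder.Language.graph.Symbols := by
  have : Finite (Σ n, FirstOrder.Language.graph.Relations n) := by
    refine Finite.of_surjective (fun _ : Unit => ⟨2, FirstOrder.Language.adj⟩) ?_
    rintro ⟨_, ⟨⟩⟩
    exact ⟨(), rfl⟩
  have : IsEmpty (Σ n, FirstOrder.Language.graph.Functions n) := ⟨fun f => isEmptyElim f.2⟩
  exact inferInstanceAs (Finite (_ ⊕ _))

/-- The structure `⟨V, edg⟩` for a binary relation `edg` on `V`. -/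
def digraph (V : Type) [Finite V] (edg : V → V → Prop) : FinStr FirstOrder.Language.graph :=
  .ofRel _ V fun
    | _, .adj, x => edg (x 0) (x 1)

instance (m n : ℕ) : Finite {x : List (Fin m) // x.length < n} :=
  (List.finite_length_lt (Fin m) n).to_subtype

/-- The complete `m`-ary tree `m^{<n}` of height `n`, as a successor-tree: the vertices are the
sequences over `{0, …, m-1}` of length less than `n`, with edges from `x` to `x d`. -/
def completeTree (m n : ℕ) : FinStr FirstOrder.Language.graph :=
  digraph {x : List (Fin m) // x.length < n} fun x y => ∃ d, y.1 = x.1 ++ [d]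

/-- `T_n`: the class of all complete `m`-ary trees of height `n`, for `m ∈ ℕ`. -/
def treeClass (n : ℕ) : Set (FinStr FirstOrder.Language.graph) :=
  Set.range fun m => completeTree m n

/-- `P`: the class of all (finite, undirected, nonempty) paths. -/
def pathClass : Set (FinStr FirstOrder.Language.graph) :=
  Set.range fun l : ℕ => digraph (Fin (l + 1)) (SimpleGraph.pathGraph (l + 1)).Adj

end MSOTransduction

namespace MSOTransduction

open scoped FirstOrder
open FirstOrder.Language.Structure (RelMap)

/-! ### Normal spanning forests -/

/-! Everything depends on the lengths of simple paths in the incidence graphs of the members of `C`.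

Suppose that these lengths are unbounded. A simple path in an incidence graph alternates between
elements and tuples, so it is a subdivision of a path. Unary parameters can guess it, and two copies
of its tuples supply both directions of every edge. Hence the paths lie below `C`
(`pathClass_belowIn`); this is the conclusion of (1), and it contradicts the strictness assumed in
(2).

Suppose that `d` bounds the lengths. Lexicographically least simple paths place every incidence
graph on a forest of height at most `d` in which incident points are comparable
(`exists_normal_forest`). The lower end of an incidence can then store the level of the upper end,
so `C` lies below the trees of height `d + 1` (`belowIn_treeClass`), which is the conclusion of (2).
The trees of height `d + 2`, on the other hand, do not lie below `C` (`not_treeClass_belowIn`), so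
the premise of (1) fails.

This last claim rests on a composition argument. At a node `s` of the forest the structure falls
into parts, one for each child of `s` and one for the rest, which overlap only in boundedly many
named points. The types of the parts determine the type of the whole (`rankType_univ_eq_of_perm`),
so whether a formula relates points of different parts depends on finitely many colours. A tree edge
is incident with only two nodes; hence only boundedly many nodes of a definable tree have incidences
across parts (`exists_cover`). If the degree is large, the subtree at some child of the root avoids
these nodes, and being connected it sits below a single child of `s` (`IsTreeBelow.step`). Each
descent costs one level of the tree, and the forest is exhausted before a tree of height `d + 2` is.
-/

lemma prefix_or_prefix_or_branch {X : Type*} : ∀ l₁ l₂ : List X,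
    l₁ <+: l₂ ∨ l₂ <+: l₁ ∨
      ∃ p a b t₁ t₂, a ≠ b ∧ l₁ = p ++ a :: t₁ ∧ l₂ = p ++ b :: t₂
  | [], _ => .inl (List.nil_prefix)
  | _, [] => .inr (.inl (List.nil_prefix))
  | a :: l₁, b :: l₂ => by
    by_cases hab : a = b
    · subst hab
      rcases prefix_or_prefix_or_branch l₁ l₂ with h | h | ⟨p, a', b', t₁, t₂, h, rfl, rfl⟩
      · exact .inl (by simpa using h)
      · exact .inr (.inl (by simpa using h))
      · exact .inr (.inr ⟨a :: p, a', b', t₁, t₂, h, rfl, rfl⟩)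
    · exact .inr (.inr ⟨[], a, b, l₁, l₂, hab, rfl, rfl⟩)

/-- `l` is a simple path in the graph `adj`. -/
def IsSimplePath {X : Type*} (adj : X → X → Prop) (l : List X) : Prop :=
  l.Nodup ∧ l.IsChain adj

lemma lt_of_branch {X : Type*} [LinearOrder X] {a b : X} (h : a < b) (p t₁ t₂ : List X) :
    p ++ a :: t₁ < p ++ b :: t₂ := by
  induction p with
  | nil => exact List.Lex.rel h
  | cons x p ih => exact List.Lex.cons ih

/-- The path to `x` yields a path to `y` that still goes through `p ++ [a]` and so beats the minimal
one: cut it at `y` if `y` occurs on it, and otherwise append `y`. The cut falls after `p`, because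
`y` ends the other path and cannot repeat in `p`. -/
lemma not_branch_of_minimal {X : Type*} [LinearOrder X] {adj : X → X → Prop} {x y : X}
    (hxy : adj x y) {p t₁ t₂ : List X} {a b : X} (hab : a < b)
    (hx : IsSimplePath adj (p ++ a :: t₁)) (hxl : (p ++ a :: t₁).getLast? = some x)
    (hy : IsSimplePath adj (p ++ b :: t₂)) (hyl : (p ++ b :: t₂).getLast? = some y)
    (hmin : ∀ l, IsSimplePath adj l → l.getLast? = some y → p ++ b :: t₂ ≤ l) : False := by
  by_cases hmem : y ∈ p ++ a :: t₁
  · rcases List.mem_append.1 hmem with hp | ha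
    · have h1 : y ∈ b :: t₂ := by
        rw [List.getLast?_append_of_ne_nil _ (by simp)] at hyl
        exact List.mem_of_getLast? hyl
      exact (List.nodup_append.1 hy.1).2.2 y hp y h1 rfl
    · obtain ⟨q, t, hq⟩ := List.append_of_mem ha
      have hpre : p ++ (q ++ [y]) <+: p ++ a :: t₁ := ⟨t, by simp [hq]⟩
      have h1 := hmin (p ++ (q ++ [y])) ⟨hx.1.sublist hpre.sublist, hx.2.prefix hpre⟩
        (by simp [← List.append_assoc])
      obtain ⟨t', ht'⟩ : ∃ t', q ++ [y] = a :: t' := by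
        cases q with
        | nil => exact ⟨[], by simp at hq; simp [hq.1]⟩
        | cons c q => exact ⟨q ++ [y], by simp at hq; simp [hq.1]⟩
      rw [ht'] at h1
      exact absurd (lt_of_branch hab p t' t₂) (not_lt.2 h1)
  · have h1 := hmin ((p ++ a :: t₁) ++ [y])
      ⟨hx.1.append (List.nodup_singleton y) (by simpa using hmem),
        List.isChain_append.2 ⟨hx.2, by simp, by simp [hxl, hxy]⟩⟩ List.getLast?_concat
    have h2 := lt_of_branch hab p (t₁ ++ [y]) t₂
    exact absurd h2 (not_lt.2 (by simpa using h1))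

/-- A finite graph has a spanning forest whose branches are simple paths and such that adjacent
vertices lie on a common branch. A vertex is mapped to the branch leading to it. -/
theorem exists_normal_forest {X : Type} [Finite X] (adj : X → X → Prop)
    (hsymm : ∀ x y, adj x y → adj y x) :
    ∃ f : X → List X, (∀ x, IsSimplePath adj (f x)) ∧ (∀ x, (f x).getLast? = some x) ∧
      ∀ x y, adj x y → f x <+: f y ∨ f y <+: f x := by
  have := Fintype.ofFinite X
  -- The order is arbitrary. The branch of `x` will be the lexicographically least simple path
  -- ending in `x`, with any starting point; it exists because simple paths have at most `card X`
  -- vertices.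
  let : LinearOrder X := LinearOrder.lift' (Finite.equivFin X) (Finite.equivFin X).injective
  have hex : ∀ x, ∃ l, (IsSimplePath adj l ∧ l.getLast? = some x) ∧
      ∀ l', IsSimplePath adj l' → l'.getLast? = some x → l ≤ l' := by
    intro x
    have hfin : {l : List X | IsSimplePath adj l ∧ l.getLast? = some x}.Finite :=
      (List.finite_length_le X (Fintype.card X)).subset fun l hl => hl.1.1.length_le_card
    obtain ⟨l, hl, hm⟩ := Set.exists_min_image _ id hfin
      ⟨[x], ⟨by simp, by simp⟩, by simp⟩
    exact ⟨l, hl, fun l' h h' => hm l' ⟨h, h'⟩⟩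
  choose f hf hmin using hex
  refine ⟨f, fun x => (hf x).1, fun x => (hf x).2, fun x y hxy => ?_⟩
  rcases prefix_or_prefix_or_branch (f x) (f y) with h | h | ⟨p, a, b, t₁, t₂, hab, h₁, h₂⟩
  · exact .inl h
  · exact .inr h
  · exfalso
    have hx := hf x
    have hy := hf y
    have mx := hmin x
    have my := hmin y
    rw [h₁] at hx mx
    rw [h₂] at hy my
    rcases lt_or_gt_of_ne hab with h | h
    · exact not_branch_of_minimal hxy h hx.1 hx.2 hy.1 hy.2 my
    · exact not_branch_of_minimal (hsymm _ _ hxy) h hy.1 hy.2 hx.1 hx.2 mx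

/-! ### Derived MSO-formulae -/

section

variable {L : FirstOrder.Language.{0, 0}}

namespace MSO

def or {n : ℕ} (φ ψ : MSO L n) : MSO L n := neg (and (neg φ) (neg ψ))

def imp {n : ℕ} (φ ψ : MSO L n) : MSO L n := neg (and φ (neg ψ))

def all {n : ℕ} (φ : MSO L (n + 1)) : MSO L n := neg (ex (neg φ))

def tru {n : ℕ} : MSO L n := all (sub (Fin.last n) (Fin.last n))

/-- `X_i` is empty -/
def emp {n : ℕ} (i : Fin n) : MSO L n := all (sub i.castSucc (Fin.last n))

/-- `X_i` is a singleton -/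
def sing {n : ℕ} (i : Fin n) : MSO L n :=
  and (neg (emp i))
    (all (imp (sub (Fin.last n) i.castSucc) (or (emp (Fin.last n)) (sub i.castSucc (Fin.last n)))))

/-- quantification over elements -/
def exElt {n : ℕ} (φ : MSO L (n + 1)) : MSO L n := ex (and (sing (Fin.last n)) φ)

def allElt {n : ℕ} (φ : MSO L (n + 1)) : MSO L n := neg (exElt (neg φ))

/-- finite disjunctions -/
noncomputable def bigOr {n : ℕ} {ι : Type} [Finite ι] (φ : ι → MSO L n) : MSO L n :=
  haveI := Fintype.ofFinite ι
  ((Finset.univ : Finset ι).toList.map φ).foldr or (neg tru)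

def un {n : ℕ} (R : L.Relations 1) (i : Fin n) : MSO L n := rel R ![i]

def bin {n : ℕ} (R : L.Relations 2) (i j : Fin n) : MSO L n := rel R ![i, j]

variable {A : Type} [L.Structure A] {n : ℕ} (V : Fin n → Set A)

lemma realize_sub (i j : Fin n) : (sub i j : MSO L n).Realize V ↔ V i ⊆ V j := Iff.rfl

lemma realize_neg (φ : MSO L n) : (neg φ).Realize V ↔ ¬ φ.Realize V := Iff.rfl

lemma realize_and (φ ψ : MSO L n) : (and φ ψ).Realize V ↔ φ.Realize V ∧ ψ.Realize V := Iff.rfl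

lemma realize_ex (φ : MSO L (n + 1)) : (ex φ).Realize V ↔
    ∃ X : Set A, φ.Realize (Fin.snoc (α := fun _ => Set A) V X) := Iff.rfl

lemma realize_or (φ ψ : MSO L n) : (or φ ψ).Realize V ↔ φ.Realize V ∨ ψ.Realize V := by
  simp only [or, realize_neg, realize_and]; tauto

lemma realize_imp (φ ψ : MSO L n) : (imp φ ψ).Realize V ↔ (φ.Realize V → ψ.Realize V) := by
  simp only [imp, realize_neg, realize_and]; tauto

lemma realize_all (φ : MSO L (n + 1)) : (all φ).Realize V ↔
    ∀ X : Set A, φ.Realize (Fin.snoc (α := fun _ => Set A) V X) := by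
  simp [all, realize_neg, realize_ex]

lemma realize_tru : (tru : MSO L n).Realize V := by
  simp [tru, realize_all, realize_sub]

lemma realize_emp (i : Fin n) : (emp i : MSO L n).Realize V ↔ V i = ∅ := by
  simp only [emp, realize_all, realize_sub, Fin.snoc_castSucc, Fin.snoc_last]
  exact ⟨fun h => Set.subset_empty_iff.1 (h ∅), fun h X => by simp [h]⟩

lemma realize_sing (i : Fin n) : (sing i : MSO L n).Realize V ↔ ∃ a, V i = {a} := by
  simp only [sing, realize_and, realize_neg, realize_emp, realize_all, realize_imp, realize_or,
    realize_sub, Fin.snoc_castSucc, Fin.snoc_last]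
  constructor
  · rintro ⟨h, h'⟩
    obtain ⟨a, ha⟩ := Set.nonempty_iff_ne_empty.2 h
    refine ⟨a, Set.Subset.antisymm ?_ (by simpa using ha)⟩
    simpa using h' {a} (by simpa using ha)
  · rintro ⟨a, ha⟩
    rw [ha]
    refine ⟨by simp, fun X hX => ?_⟩
    rcases Set.subset_singleton_iff_eq.1 hX with h | h <;> simp [h]

lemma realize_exElt (φ : MSO L (n + 1)) : (exElt φ).Realize V ↔
    ∃ a : A, φ.Realize (Fin.snoc (α := fun _ => Set A) V {a}) := by
  simp only [exElt, realize_ex, realize_and, realize_sing, Fin.snoc_last]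
  constructor
  · rintro ⟨X, ⟨a, rfl⟩, h⟩
    exact ⟨a, h⟩
  · rintro ⟨a, h⟩
    exact ⟨_, ⟨a, rfl⟩, h⟩

lemma realize_allElt (φ : MSO L (n + 1)) : (allElt φ).Realize V ↔
    ∀ a : A, φ.Realize (Fin.snoc (α := fun _ => Set A) V {a}) := by
  simp [allElt, realize_neg, realize_exElt]

lemma realize_bigOr {ι : Type} [Finite ι] (φ : ι → MSO L n) : (bigOr φ).Realize V ↔
    ∃ i, (φ i).Realize V := by
  have : ∀ l : List ι, ((l.map φ).foldr or (neg tru)).Realize V ↔ ∃ i ∈ l, (φ i).Realize V := by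
    intro l
    induction l with
    | nil => simp [realize_neg, realize_tru]
    | cons i l ih => simp [realize_or, ih]
  simp [bigOr, this]

lemma realize_un (R : L.Relations 1) (i : Fin n) : (un R i).Realize V ↔
    ∃ a ∈ V i, FirstOrder.Language.Structure.RelMap R ![a] := by
  constructor
  · rintro ⟨a, h, h'⟩
    refine ⟨a 0, h 0, ?_⟩
    convert h' using 1
    funext j; fin_cases j; rfl
  · rintro ⟨a, h, h'⟩
    exact ⟨![a], fun j => by fin_cases j; exact h, h'⟩

lemma realize_bin (R : L.Relations 2) (i j : Fin n) : (bin R i j).Realize V ↔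
    ∃ a ∈ V i, ∃ b ∈ V j, FirstOrder.Language.Structure.RelMap R ![a, b] := by
  constructor
  · rintro ⟨a, h, h'⟩
    refine ⟨a 0, h 0, a 1, h 1, ?_⟩
    convert h' using 1
    funext j; fin_cases j <;> rfl
  · rintro ⟨a, h, b, hb, h'⟩
    exact ⟨![a, b], fun j => by fin_cases j; exacts [h, hb], h'⟩

end MSO

end

/-! ### Incidence structures -/

section

variable {L : FirstOrder.Language.{0, 0}} [L.IsRelational]

/-- The positions in tuples, i.e. the numbers below the maximal arity. -/
abbrev Position (L : FirstOrder.Language.{0, 0}) : Type :=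
  {p : ℕ // ∃ n, p < n ∧ Nonempty (L.Relations n)}

omit [L.IsRelational] in
lemma finite_sigma_relations [Finite L.Symbols] : Finite (Σ n, L.Relations n) :=
  Finite.of_injective (Sum.inr : _ → L.Symbols) Sum.inr_injective

instance [Finite L.Symbols] : Finite (Position L) := by
  have := finite_sigma_relations (L := L)
  refine Finite.of_surjective
    (fun q : Σ R : (Σ n, L.Relations n), Fin R.1 => (⟨q.2, q.1.1, q.2.2, ⟨q.1.2⟩⟩ : Position L)) ?_
  rintro ⟨p, n, h, ⟨R⟩⟩
  exact ⟨⟨⟨n, R⟩, ⟨p, h⟩⟩, rfl⟩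

variable [Finite L.Symbols]

/-- An element as a point of the incidence structure. -/
def FinStr.elt (A : FinStr L) (a : A.carrier) : A.incidence.carrier := .inl a

/-- A tuple as a point of the incidence structure. -/
def FinStr.tup (A : FinStr L) (c : A.Tuples) : A.incidence.carrier := .inr c

lemma FinStr.elt_inj {A : FinStr L} {a b : A.carrier} : A.elt a = A.elt b ↔ a = b :=
  Sum.inl_injective.eq_iff

lemma FinStr.tup_inj {A : FinStr L} {c d : A.Tuples} : A.tup c = A.tup d ↔ c = d :=
  Sum.inr_injective.eq_iff

lemma FinStr.elt_ne_tup {A : FinStr L} {a : A.carrier} {c : A.Tuples} : A.elt a ≠ A.tup c :=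
  Sum.inl_ne_inr

lemma FinStr.elt_or_tup {A : FinStr L} (x : A.incidence.carrier) :
    (∃ a, x = A.elt a) ∨ ∃ c, x = A.tup c := by
  cases x with
  | inl a => exact .inl ⟨a, rfl⟩
  | inr c => exact .inr ⟨c, rfl⟩

/-- `x` is the component of the tuple `y` at position `p`. -/
def FinStr.IncAt (A : FinStr L) (p : ℕ) (x y : A.incidence.carrier) : Prop :=
  ∃ (a : A.carrier) (c : A.Tuples), x = A.elt a ∧ y = A.tup c ∧
    ∃ h : p < c.1.1, a = c.1.2 ⟨p, h⟩

/-- The adjacency relation of the incidence graph. -/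
def FinStr.IncAdj (A : FinStr L) (x y : A.incidence.carrier) : Prop :=
  ∃ p, A.IncAt p x y ∨ A.IncAt p y x

lemma FinStr.IncAdj.symm {A : FinStr L} {x y : A.incidence.carrier} (h : A.IncAdj x y) :
    A.IncAdj y x := by
  obtain ⟨p, h⟩ := h
  exact ⟨p, h.symm⟩

lemma FinStr.IncAt.unique {A : FinStr L} {p : ℕ} {x x' y : A.incidence.carrier}
    (h : A.IncAt p x y) (h' : A.IncAt p x' y) : x = x' := by
  obtain ⟨a, c, rfl, rfl, hp, rfl⟩ := h
  obtain ⟨a', c', rfl, hc, hp', rfl⟩ := h'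
  obtain rfl := FinStr.tup_inj.1 hc
  rfl

lemma FinStr.IncAt.position {A : FinStr L} {p : ℕ} {x y : A.incidence.carrier}
    (h : A.IncAt p x y) : ∃ n, p < n ∧ Nonempty (L.Relations n) := by
  obtain ⟨a, c, rfl, rfl, hp, rfl⟩ := h
  obtain ⟨R, -⟩ := c.2
  exact ⟨_, hp, ⟨R⟩⟩

lemma FinStr.relMap_inc (A : FinStr L) (p : ℕ) (h) (x : Fin 2 → A.incidence.carrier) :
    RelMap (L := incLang L) (IncRel.inc p h) x ↔ A.IncAt p (x 0) (x 1) := Iff.rfl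

end

/-! ### The incidence structure of a directed graph -/

section

variable {V : Type} [Finite V] {edg : V → V → Prop}

/-- A vertex as a point of the incidence structure. -/
def vertexPoint (edg : V → V → Prop) (v : V) : (digraph V edg).incidence.carrier :=
  (digraph V edg).elt v

/-- An edge as a point of the incidence structure. -/
def edgePoint {u v : V} (h : edg u v) : (digraph V edg).incidence.carrier :=
  (digraph V edg).tup ⟨⟨2, ![u, v]⟩, FirstOrder.Language.adj, h⟩

lemma exists_tup_eq_edgePoint (c : (digraph V edg).Tuples) :
    ∃ (u v : V) (h : edg u v), (digraph V edg).tup c = edgePoint h := by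
  obtain ⟨⟨n, a⟩, R, hR⟩ := c
  change FirstOrder.Language.graph.Relations n at R
  cases R
  refine ⟨a 0, a 1, hR, congrArg _ (Subtype.ext ?_)⟩
  change (⟨2, a⟩ : Σ n, Fin n → V) = ⟨2, ![a 0, a 1]⟩
  congr 1
  funext i; fin_cases i <;> rfl

lemma vertex_or_edge (x : (digraph V edg).incidence.carrier) :
    (∃ v, x = vertexPoint edg v) ∨ ∃ (u v : V) (h : edg u v), x = edgePoint h := by
  rcases FinStr.elt_or_tup x with ⟨a, rfl⟩ | ⟨c, rfl⟩
  · exact .inl ⟨a, rfl⟩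
  · exact .inr (exists_tup_eq_edgePoint c)

lemma vertexPoint_inj {u v : V} : vertexPoint edg u = vertexPoint edg v ↔ u = v :=
  FinStr.elt_inj

lemma edgePoint_inj {u v u' v' : V} {h : edg u v} {h' : edg u' v'} :
    edgePoint h = edgePoint h' ↔ u = u' ∧ v = v' := by
  constructor
  · intro H
    have H1 : (⟨2, ![u, v]⟩ : Σ n, Fin n → V) = ⟨2, ![u', v']⟩ :=
      congrArg Subtype.val (FinStr.tup_inj.1 H)
    have H2 : ![u, v] = ![u', v'] := eq_of_heq (Sigma.mk.inj H1).2
    exact ⟨congrFun H2 0, congrFun H2 1⟩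
  · rintro ⟨rfl, rfl⟩; rfl

lemma vertexPoint_ne_edgePoint {u v w : V} {h : edg u v} : vertexPoint edg w ≠ edgePoint h :=
  FinStr.elt_ne_tup

lemma incAt_zero_iff {x y : (digraph V edg).incidence.carrier} :
    (digraph V edg).IncAt 0 x y ↔
      ∃ (u v : V) (h : edg u v), x = vertexPoint edg u ∧ y = edgePoint h := by
  constructor
  · rintro ⟨a, c, rfl, rfl, hp, ha⟩
    obtain ⟨u, v, h, hc⟩ := exists_tup_eq_edgePoint c
    obtain rfl := FinStr.tup_inj.1 hc
    exact ⟨u, v, h, by rw [ha]; rfl, rfl⟩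
  · rintro ⟨u, v, h, rfl, rfl⟩
    exact ⟨u, _, rfl, rfl, Nat.zero_lt_two, rfl⟩

lemma incAt_one_iff {x y : (digraph V edg).incidence.carrier} :
    (digraph V edg).IncAt 1 x y ↔
      ∃ (u v : V) (h : edg u v), x = vertexPoint edg v ∧ y = edgePoint h := by
  constructor
  · rintro ⟨a, c, rfl, rfl, hp, ha⟩
    obtain ⟨u, v, h, hc⟩ := exists_tup_eq_edgePoint c
    obtain rfl := FinStr.tup_inj.1 hc
    exact ⟨u, v, h, by rw [ha]; rfl, rfl⟩
  · rintro ⟨u, v, h, rfl, rfl⟩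
    exact ⟨v, _, rfl, rfl, Nat.one_lt_two, rfl⟩

lemma relMap_P_iff {n : ℕ} (R : FirstOrder.Language.graph.Relations n)
    (x : Fin 1 → (digraph V edg).incidence.carrier) :
    RelMap (L := incLang FirstOrder.Language.graph) (IncRel.P R) x ↔
      ∃ (u v : V) (h : edg u v), x 0 = edgePoint h := by
  cases R
  constructor
  · rintro ⟨c, h, -⟩
    obtain ⟨u, v, hc⟩ := exists_tup_eq_edgePoint c
    exact ⟨u, v, hc.1, h.trans hc.2⟩
  · rintro ⟨u, v, h, h'⟩
    exact ⟨_, h', ![u, v], rfl, h⟩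

lemma graph_position_lt {p : ℕ} (h : ∃ n, p < n ∧ Nonempty (FirstOrder.Language.graph.Relations n)) :
    p = 0 ∨ p = 1 := by
  obtain ⟨n, h, ⟨⟨⟩⟩⟩ := h
  omega

end

/-! ### Formulae over copies of expansions -/

section

variable {K : FirstOrder.Language.{0, 0}} [K.IsRelational] {m k : ℕ}

def baseSym {n : ℕ} (m k : ℕ) (R : K.Relations n) :
    (copyLang (expLang K m) k).Relations n := .inl (.inl R)

def paramSym (K : FirstOrder.Language.{0, 0}) {m : ℕ} (k : ℕ) (i : Fin m) :
    (copyLang (expLang K m) k).Relations 1 := .inl (.inr (.param i))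

def partSym (K : FirstOrder.Language.{0, 0}) (m : ℕ) {k : ℕ} (h : 2 ≤ k) (i : Fin k) :
    (copyLang (expLang K m) k).Relations 1 := .inr (.part h i)

def simSym (K : FirstOrder.Language.{0, 0}) (m : ℕ) {k : ℕ} (h : 2 ≤ k) :
    (copyLang (expLang K m) k).Relations 2 := .inr (.sim h)

variable (I : FinStr K) (Q : Fin m → Set I.carrier)

lemma relMap_baseSym {n : ℕ} (R : K.Relations n) (x : Fin n → I.carrier × Fin k) :
    RelMap (M := ((I.exp Q).copy k).carrier) (baseSym m k R) x ↔
      (∃ i, ∀ j, (x j).2 = i) ∧ RelMap R fun j => (x j).1 := by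
  constructor
  · rintro ⟨i, h, h'⟩
    exact ⟨⟨i, h⟩, h'⟩
  · rintro ⟨⟨i, h⟩, h'⟩
    exact ⟨i, h, h'⟩

variable {n : ℕ} (V : Fin n → Set (I.carrier × Fin k))

/-- Satisfaction in `copy_k (I, Q)`. -/
def CopyRealize (φ : MSO (copyLang (expLang K m) k) n) : Prop :=
  MSO.Realize (A := ((I.exp Q).copy k).carrier) φ V

namespace CopyRealize

lemma and (φ ψ : MSO (copyLang (expLang K m) k) n) :
    CopyRealize I Q V (.and φ ψ) ↔ CopyRealize I Q V φ ∧ CopyRealize I Q V ψ := Iff.rfl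

lemma or (φ ψ : MSO (copyLang (expLang K m) k) n) :
    CopyRealize I Q V (.or φ ψ) ↔ CopyRealize I Q V φ ∨ CopyRealize I Q V ψ :=
  MSO.realize_or (A := ((I.exp Q).copy k).carrier) V _ _

lemma imp (φ ψ : MSO (copyLang (expLang K m) k) n) :
    CopyRealize I Q V (.imp φ ψ) ↔ (CopyRealize I Q V φ → CopyRealize I Q V ψ) :=
  MSO.realize_imp (A := ((I.exp Q).copy k).carrier) V _ _

lemma tru : CopyRealize I Q V .tru :=
  MSO.realize_tru (A := ((I.exp Q).copy k).carrier) V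

lemma bigOr {ι : Type} [Finite ι] (φ : ι → MSO (copyLang (expLang K m) k) n) :
    CopyRealize I Q V (.bigOr φ) ↔ ∃ i, CopyRealize I Q V (φ i) :=
  MSO.realize_bigOr (A := ((I.exp Q).copy k).carrier) V _

lemma sub (i j : Fin n) : CopyRealize I Q V (.sub i j) ↔ V i ⊆ V j := Iff.rfl

lemma all (φ : MSO (copyLang (expLang K m) k) (n + 1)) : CopyRealize I Q V (.all φ) ↔
    ∀ X : Set (I.carrier × Fin k), CopyRealize I Q (Fin.snoc (α := fun _ => _) V X) φ :=
  MSO.realize_all (A := ((I.exp Q).copy k).carrier) V _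

lemma exElt (φ : MSO (copyLang (expLang K m) k) (n + 1)) : CopyRealize I Q V (.exElt φ) ↔
    ∃ x : I.carrier × Fin k, CopyRealize I Q (Fin.snoc (α := fun _ => _) V {x}) φ :=
  MSO.realize_exElt (A := ((I.exp Q).copy k).carrier) V _

lemma allElt (φ : MSO (copyLang (expLang K m) k) (n + 1)) : CopyRealize I Q V (.allElt φ) ↔
    ∀ x : I.carrier × Fin k, CopyRealize I Q (Fin.snoc (α := fun _ => _) V {x}) φ :=
  MSO.realize_allElt (A := ((I.exp Q).copy k).carrier) V _

lemma param (q : Fin m) (i : Fin n) :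
    CopyRealize I Q V (.un (paramSym K k q) i) ↔ ∃ x ∈ V i, x.1 ∈ Q q := by
  refine (MSO.realize_un (A := ((I.exp Q).copy k).carrier) V _ _).trans ?_
  refine exists_congr fun x => and_congr_right fun _ => ?_
  constructor
  · rintro ⟨j, -, h⟩
    exact h
  · intro h
    exact ⟨x.2, fun j => by fin_cases j; rfl, h⟩

lemma part (h : 2 ≤ k) (c : Fin k) (i : Fin n) :
    CopyRealize I Q V (.un (partSym K m h c) i) ↔ ∃ x ∈ V i, x.2 = c :=
  MSO.realize_un (A := ((I.exp Q).copy k).carrier) V _ _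

lemma sim (h : 2 ≤ k) (i j : Fin n) :
    CopyRealize I Q V (.bin (simSym K m h) i j) ↔ ∃ x ∈ V i, ∃ y ∈ V j, x.1 = y.1 :=
  MSO.realize_bin (A := ((I.exp Q).copy k).carrier) V _ _ _

lemma base (R : K.Relations 2) (i j : Fin n) :
    CopyRealize I Q V (.bin (baseSym m k R) i j) ↔
      ∃ x ∈ V i, ∃ y ∈ V j, x.2 = y.2 ∧ RelMap R ![x.1, y.1] := by
  refine (MSO.realize_bin (A := ((I.exp Q).copy k).carrier) V _ _ _).trans ?_
  refine exists_congr fun x => and_congr_right fun _ => exists_congr fun y =>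
    and_congr_right fun _ => ?_
  refine (relMap_baseSym I Q R _).trans (and_congr ⟨?_, ?_⟩ (iff_of_eq ?_))
  · rintro ⟨c, h⟩
    exact (h 0).trans (h 1).symm
  · intro h
    exact ⟨y.2, fun j => by fin_cases j; exacts [h, rfl]⟩
  · congr 1
    funext j; fin_cases j <;> rfl

end CopyRealize

end

/-- The incidence relation at position `p`. -/
def incSym {L : FirstOrder.Language.{0, 0}} {p : ℕ} (h : ∃ n, p < n ∧ Nonempty (L.Relations n)) :
    (incLang L).Relations 2 := IncRel.inc p h

lemma CopyRealize.inc {L : FirstOrder.Language.{0, 0}} [L.IsRelational] [Finite L.Symbols]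
    {m k n : ℕ} (A : FinStr L) (Q : Fin m → Set A.incidence.carrier)
    (V : Fin n → Set (A.incidence.carrier × Fin k)) {p : ℕ}
    (h : ∃ n, p < n ∧ Nonempty (L.Relations n)) (i j : Fin n) :
    CopyRealize A.incidence Q V (.bin (baseSym m k (incSym h)) i j) ↔
      ∃ x ∈ V i, ∃ y ∈ V j, x.2 = y.2 ∧ A.IncAt p x.1 y.1 :=
  CopyRealize.base _ _ _ _ _ _

lemma snoc_two {α : Type*} (x y z : α) :
    (Fin.snoc (α := fun _ => α) ![x, y] z : Fin 3 → α) = ![x, y, z] := by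
  funext i; fin_cases i <;> rfl

/-- A way to show that `B` is an image of `I`: both are compared with an index set `X`. -/
lemma maps_of_equiv {K K' : FirstOrder.Language.{0, 0}} [K.IsRelational] [K'.IsRelational]
    (τ : Transduction K K') (I : FinStr K) (B : FinStr K') (Q : Fin τ.m → Set I.carrier)
    {X : Type} (H : X → B.carrier) (hH : Function.Bijective H) (G : X → I.carrier × Fin τ.k)
    (hG : Function.Injective G)
    (hχ : ∀ V, CopyRealize I Q V τ.base.χ)
    (hδ : ∀ y, CopyRealize I Q ![{y}] τ.base.δ ↔ ∃ x, G x = y)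
    (hφ : ∀ (n : ℕ) (R : K'.Relations n) (x : Fin n → X),
      CopyRealize I Q (fun i => {G (x i)}) (τ.base.φ R) ↔
        RelMap R fun i => H (x i)) :
    τ.Maps I B := by
  have hδ (y : I.carrier × Fin τ.k) :
      τ.base.δ.RealizeAt (A := ((I.exp Q).copy τ.k).carrier) ![y] ↔ ∃ x, G x = y := by
    rw [← hδ, MSO.RealizeAt, CopyRealize]
    exact iff_of_eq (congrArg _ (by funext i; fin_cases i; rfl))
  refine ⟨Q, hχ _, ?_⟩
  let e : X ≃ (τ.base.output ((I.exp Q).copy τ.k)).carrier :=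
    Equiv.ofBijective (fun x => ⟨G x, (hδ _).2 ⟨x, rfl⟩⟩)
      ⟨fun x y h => hG (congrArg Subtype.val h), fun y => by
        obtain ⟨x, hx⟩ := (hδ _).1 y.2
        exact ⟨x, Subtype.ext hx⟩⟩
  let h := Equiv.ofBijective H hH
  refine ⟨⟨h.symm.trans e, fun f => isEmptyElim f, fun {n} R x => ?_⟩⟩
  have := hφ n R fun i => h.symm (x i)
  have hx : (fun i => H (h.symm (x i))) = x := funext fun i => h.apply_symm_apply (x i)
  rw [hx] at this
  exact this

/-! ### Interpreting paths in incidence structures with long paths -/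

section

variable {L : FirstOrder.Language.{0, 0}} [L.IsRelational]

namespace PathInterpretation

variable {m : ℕ} (e : Option (Bool × Position L) ≃ Fin m)

/-- `X_i` belongs to the tuples used by the path. -/
noncomputable def edgeFormula [Finite L.Symbols] {n : ℕ} (i : Fin n) :
    MSO (copyLang (expLang (incLang L) m) 2) n :=
  .bigOr fun p : Position L => .un (paramSym (incLang L) 2 (e (some (false, p)))) i

/-- The points used by the path. -/
noncomputable def domFormula [Finite L.Symbols] : MSO (copyLang (expLang (incLang L) m) 2) 1 :=
  .or (.and (.un (paramSym (incLang L) 2 (e none)) 0)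
    (.un (partSym (incLang L) m le_rfl 0) 0)) (edgeFormula e 0)

/-- The incidence relation of the path. The first copy of a tuple is the edge in the direction of
the path, the second copy is the edge in the opposite direction. -/
noncomputable def incFormula [Finite L.Symbols] (b : Bool) :
    MSO (copyLang (expLang (incLang L) m) 2) 2 :=
  .and (.un (paramSym (incLang L) 2 (e none)) 0) <| .bigOr fun p : Position L => .exElt <|
    -- Incidence holds only within one copy, and path vertices live in copy 0. An edge from copy 1
    -- is therefore replaced by its twin in the copy of the vertex.
    .and (.and (.bin (simSym (incLang L) m le_rfl) 1 2)
        (.bin (baseSym m 2 (incSym p.2)) 0 2))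
      (.or (.and (.un (partSym (incLang L) m le_rfl 0) 1)
          (.un (paramSym (incLang L) 2 (e (some (b, p)))) 1))
        (.and (.un (partSym (incLang L) m le_rfl 1) 1)
          (.un (paramSym (incLang L) 2 (e (some (!b, p)))) 1)))

/-- The parameter `none` marks the path vertices, and `(b, p)` marks the tuples whose end `b` on the
path stands at position `p`. The marks are needed because a tuple may have further components that
also lie on the path. -/
noncomputable def transduction [Finite L.Symbols] :
    Transduction (incLang L) (incLang FirstOrder.Language.graph) where
  k := 2
  one_le_k := by omega
  m := m
  base :=
    { χ := .tru
      δ := domFormula e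
      φ := fun R => match R with
        | .P _ => edgeFormula e 0
        | .inc p _ => incFormula e (p == 1) }

/-- The end-points of the `i`-th edge of a path. -/
def endPoint {l : ℕ} (b : Bool) (i : Fin l) : Fin (l + 1) := if b then i.succ else i.castSucc

variable [Finite L.Symbols] {A : FinStr L} {l : ℕ} (a : Fin (l + 1) → A.carrier) (c : Fin l → A.Tuples)
  (pos : Bool → Fin l → Position L)

/-- The values of the parameters. -/
def params (j : Fin m) : Set A.incidence.carrier :=
  match e.symm j with
  | none => Set.range fun i => A.elt (a i)
  | some (b, p) => {y | ∃ i, pos b i = p ∧ y = A.tup (c i)}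

/-- The representation of the vertices and edges of the path. -/
def repr : Fin (l + 1) ⊕ Fin l × Fin 2 → A.incidence.carrier × Fin 2
  | .inl i => (A.elt (a i), 0)
  | .inr (i, s) => (A.tup (c i), s)

lemma mem_params_none (x) : x ∈ params e a c pos (e none) ↔ ∃ i, x = A.elt (a i) := by
  rw [params, e.symm_apply_apply]
  simp [eq_comm]

lemma mem_params_some (b p x) : x ∈ params e a c pos (e (some (b, p))) ↔
    ∃ i, pos b i = p ∧ x = A.tup (c i) := by
  rw [params, e.symm_apply_apply]
  rfl

lemma realize_edgeFormula {n : ℕ} (V : Fin n → Set (A.incidence.carrier × Fin 2)) (i : Fin n) :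
    CopyRealize A.incidence (params e a c pos) V (edgeFormula e i) ↔
      ∃ x ∈ V i, ∃ j, x.1 = A.tup (c j) := by
  rw [edgeFormula, CopyRealize.bigOr]
  simp only [CopyRealize.param]
  constructor
  · rintro ⟨p, x, hx, hj⟩
    obtain ⟨j, -, hj⟩ := (mem_params_some e a c pos _ _ _).1 hj
    exact ⟨x, hx, j, hj⟩
  · rintro ⟨x, hx, j, hj⟩
    exact ⟨pos false j, x, hx, (mem_params_some e a c pos _ _ _).2 ⟨j, rfl, hj⟩⟩

lemma realize_incFormula (b : Bool) (x y : A.incidence.carrier × Fin 2) :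
    CopyRealize A.incidence (params e a c pos) ![{x}, {y}] (incFormula e b) ↔
      (∃ j, x.1 = A.elt (a j)) ∧
        ∃ i, A.IncAt (pos (b ^^ (y.2 == 1)) i).1 x.1 y.1 ∧ y.1 = A.tup (c i) := by
  simp only [incFormula, CopyRealize.and, CopyRealize.or, CopyRealize.bigOr, CopyRealize.exElt,
    CopyRealize.param, CopyRealize.part, CopyRealize.sim, CopyRealize.inc]
  simp only [snoc_two]
  simp only [Matrix.cons_val, Set.mem_singleton_iff, exists_eq_left]
  simp only [mem_params_none, mem_params_some]
  refine and_congr_right fun ⟨v, hv⟩ => ?_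
  obtain ⟨x, s⟩ := x
  obtain ⟨y, t⟩ := y
  constructor
  · rintro ⟨p, ⟨z, s'⟩, ⟨h, -, h'⟩, ⟨ht, i, hp, hi⟩ | ⟨ht, i, hp, hi⟩⟩
    all_goals
      dsimp only at h h' ht hi
      subst h ht hp
      exact ⟨i, by simpa using h', hi⟩
  · rintro ⟨i, h, hi⟩
    refine ⟨_, (y, s), ⟨rfl, rfl, h⟩, ?_⟩
    dsimp only at hi ⊢
    fin_cases t
    · exact .inl ⟨rfl, i, by simp, hi⟩
    · exact .inr ⟨rfl, i, by simp, hi⟩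

lemma adj_endPoint {l : ℕ} (s : Fin 2) (i : Fin l) :
    (SimpleGraph.pathGraph (l + 1)).Adj (endPoint (s == 1) i) (endPoint (!(s == 1)) i) := by
  rw [SimpleGraph.pathGraph_adj]
  fin_cases s <;> simp [endPoint]

/-- The vertices and edges of a path. -/
def point (l : ℕ) : Fin (l + 1) ⊕ Fin l × Fin 2 →
    (digraph (Fin (l + 1)) (SimpleGraph.pathGraph (l + 1)).Adj).incidence.carrier
  | .inl i => vertexPoint _ i
  | .inr (i, s) => edgePoint (u := endPoint (s == 1) i) (v := endPoint (!(s == 1)) i)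
      (adj_endPoint s i)

lemma endPoint_inj {l : ℕ} {b b' : Bool} {i i' : Fin l} (h : endPoint b i = endPoint b' i')
    (h' : endPoint (!b) i = endPoint (!b') i') : b = b' ∧ i = i' := by
  cases b <;> cases b' <;> simp [endPoint, Fin.ext_iff] at * <;> omega

lemma point_bijective (l : ℕ) : Function.Bijective (point l) := by
  constructor
  · rintro (i | ⟨i, s⟩) (j | ⟨j, t⟩) h
    · exact congrArg _ (vertexPoint_inj.1 h)
    · exact (vertexPoint_ne_edgePoint (h := adj_endPoint t j) h).elim
    · exact (vertexPoint_ne_edgePoint (h := adj_endPoint s i) h.symm).elim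
    · obtain ⟨h₁, h₂⟩ :=
        (edgePoint_inj (h := adj_endPoint s i) (h' := adj_endPoint t j)).1 h
      obtain ⟨h₃, rfl⟩ := endPoint_inj h₁ h₂
      have : s = t := by
        clear h h₁ h₂
        revert s t; decide
      rw [this]
  · intro x
    rcases vertex_or_edge x with ⟨v, rfl⟩ | ⟨u, v, h, rfl⟩
    · exact ⟨.inl v, rfl⟩
    · rcases SimpleGraph.pathGraph_adj.1 h with h' | h'
      · exact ⟨.inr (⟨u, by omega⟩, 0), (edgePoint_inj (h := adj_endPoint 0 _)).2 (by simp [endPoint, h'])⟩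
      · exact ⟨.inr (⟨v, by omega⟩, 1), (edgePoint_inj (h := adj_endPoint 1 _)).2 (by simp [endPoint, h'])⟩

lemma relMap_point_iff {l : ℕ} (b : Bool) (x y : Fin (l + 1) ⊕ Fin l × Fin 2) :
    (digraph (Fin (l + 1)) (SimpleGraph.pathGraph (l + 1)).Adj).IncAt b.toNat
        (point l x) (point l y) ↔
      ∃ i s, x = .inl (endPoint (b ^^ (s == 1)) i) ∧ y = .inr (i, s) := by
  have key : (digraph (Fin (l + 1)) (SimpleGraph.pathGraph (l + 1)).Adj).IncAt b.toNat
        (point l x) (point l y) ↔ ∃ (u v : Fin (l + 1))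
          (h : (SimpleGraph.pathGraph (l + 1)).Adj u v),
          point l x = vertexPoint _ (if b then v else u) ∧ point l y = edgePoint h := by
    cases b
    · exact incAt_zero_iff
    · exact incAt_one_iff
  rw [key]
  constructor
  · rintro ⟨u, v, h, hx, hy⟩
    have hx' := (point_bijective l).1 (hx.trans (rfl : _ = point l (.inl (if b then v else u))))
    subst hx'
    rcases y with j | ⟨i, s⟩
    · exact (vertexPoint_ne_edgePoint hy).elim
    · obtain ⟨rfl, rfl⟩ := (edgePoint_inj (h := adj_endPoint s i)).1 hy
      refine ⟨i, s, ?_, rfl⟩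
      cases b <;> simp
  · rintro ⟨i, s, rfl, rfl⟩
    refine ⟨_, _, adj_endPoint s i, ?_, rfl⟩
    refine vertexPoint_inj.2 ?_
    cases b <;> simp

/-- By injectivity of `c` a tuple determines its index on the path, hence its marked positions. Each
position holds only one component, which by `hpos` is the intended end. -/
theorem maps (ha : Function.Injective a) (hc : Function.Injective c)
    (hpos : ∀ b i, A.IncAt (pos b i).1 (A.elt (a (endPoint b i))) (A.tup (c i))) :
    (transduction e).Maps A.incidence
      (digraph (Fin (l + 1)) (SimpleGraph.pathGraph (l + 1)).Adj).incidence := by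
  have hinc : ∀ (b : Bool) (x y : Fin (l + 1) ⊕ Fin l × Fin 2),
      CopyRealize A.incidence (params e a c pos) ![{repr a c x}, {repr a c y}] (incFormula e b) ↔
      ∃ i s, x = .inl (endPoint (b ^^ (s == 1)) i) ∧ y = .inr (i, s) := by
    intro b x y
    rw [realize_incFormula]
    constructor
    · rintro ⟨⟨j, hj⟩, i, h, hi⟩
      rcases y with j' | ⟨i', s⟩
      · exact (FinStr.elt_ne_tup hi).elim
      rcases x with j' | ⟨i'', s'⟩
      swap
      · exact (FinStr.elt_ne_tup hj.symm).elim
      obtain rfl := hc (FinStr.tup_inj.1 hi)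
      exact ⟨i', s, congrArg _ (ha (FinStr.elt_inj.1 (h.unique (hpos _ _)))), rfl⟩
    · rintro ⟨i, s, rfl, rfl⟩
      exact ⟨⟨_, rfl⟩, i, hpos _ _, rfl⟩
  have hdom : ∀ y, CopyRealize A.incidence (params e a c pos) ![{y}] (domFormula e) ↔
      ∃ x, repr a c x = y := by
    rintro ⟨y, s⟩
    simp only [domFormula, CopyRealize.or, CopyRealize.and, CopyRealize.param, CopyRealize.part,
      realize_edgeFormula, Matrix.cons_val, Set.mem_singleton_iff, exists_eq_left, mem_params_none]
    constructor
    · rintro (⟨⟨i, rfl⟩, rfl⟩ | ⟨i, rfl⟩)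
      · exact ⟨.inl i, rfl⟩
      · exact ⟨.inr (i, s), rfl⟩
    · rintro ⟨i | ⟨i, t⟩, h⟩
      · exact .inl ⟨⟨i, (congrArg Prod.fst h).symm⟩, (congrArg Prod.snd h).symm⟩
      · exact .inr ⟨i, (congrArg Prod.fst h).symm⟩
  have hedge : ∀ x, CopyRealize A.incidence (params e a c pos) ![{repr a c x}] (edgeFormula e 0) ↔
      ∃ y, x = .inr y := by
    rintro x
    simp only [realize_edgeFormula, Matrix.cons_val, Set.mem_singleton_iff, exists_eq_left]
    rcases x with i | ⟨i, s⟩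
    · exact ⟨fun ⟨j, h⟩ => (FinStr.elt_ne_tup h).elim, by simp⟩
    · exact ⟨fun _ => ⟨_, rfl⟩, fun _ => ⟨i, rfl⟩⟩
  refine maps_of_equiv (transduction e) A.incidence _ (params e a c pos) (point l)
    (point_bijective l) (repr a c) ?_ (fun V => CopyRealize.tru _ _ V) hdom ?_
  · rintro (i | ⟨i, s⟩) (j | ⟨j, t⟩) h
    · exact congrArg _ (ha (FinStr.elt_inj.1 (congrArg Prod.fst h)))
    · exact (FinStr.elt_ne_tup (congrArg Prod.fst h)).elim
    · exact (FinStr.elt_ne_tup (congrArg Prod.fst h).symm).elim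
    · have h₁ := hc (FinStr.tup_inj.1 (congrArg Prod.fst h))
      have h₂ : s = t := congrArg Prod.snd h
      rw [h₁, h₂]
  · rintro n (⟨R⟩ | ⟨p, hp⟩) x
    · have hV : (fun i => {repr a c (x i)} : Fin 1 → Set (A.incidence.carrier × Fin 2)) =
          ![{repr a c (x 0)}] := by
        funext i; fin_cases i; rfl
      have h := hedge (x 0)
      rw [← hV] at h
      refine (h.trans ?_).trans (relMap_P_iff R _).symm
      constructor
      · rintro ⟨y, hy⟩
        exact ⟨_, _, adj_endPoint y.2 y.1, by rw [hy]; rfl⟩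
      · rintro ⟨u, v, h, hx⟩
        rcases h' : x 0 with i | ⟨i, s⟩
        · rw [h'] at hx
          exact (vertexPoint_ne_edgePoint hx).elim
        · exact ⟨_, rfl⟩
    · have hV : (fun i => {repr a c (x i)} : Fin 2 → Set (A.incidence.carrier × Fin 2)) =
          ![{repr a c (x 0)}, {repr a c (x 1)}] := by
        funext i; fin_cases i <;> rfl
      refine Iff.trans ?_ (FinStr.relMap_inc _ _ _ _).symm
      rcases graph_position_lt hp with rfl | rfl
      · refine Iff.trans ?_ (relMap_point_iff false (x 0) (x 1)).symm
        rw [← hinc, ← hV]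
        rfl
      · refine Iff.trans ?_ (relMap_point_iff true (x 0) (x 1)).symm
        rw [← hinc, ← hV]
        rfl

end PathInterpretation

open PathInterpretation in
/-- A simple path in the incidence graph with `2 l + 2` vertices contains a path with `l + 1`
elements and `l` tuples. -/
lemma exists_alternating_path [Finite L.Symbols] (A : FinStr L) (l : ℕ)
    (p : List A.incidence.carrier) (hp : IsSimplePath A.IncAdj p) (hl : 2 * l + 2 ≤ p.length) :
    ∃ (a : Fin (l + 1) → A.carrier) (c : Fin l → A.Tuples) (pos : Bool → Fin l → Position L),
      Function.Injective a ∧ Function.Injective c ∧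
      ∀ b i, A.IncAt (pos b i).1 (A.elt (a (endPoint b i))) (A.tup (c i)) := by
  -- Dropping the first vertex if it is a tuple leaves at least `2 * l + 1` vertices, starting with
  -- an element: `l + 1` elements alternating with `l` tuples. The default `p[0]` of `getD` is never
  -- reached.
  obtain ⟨w, hw, hadj, h0⟩ : ∃ w : ℕ → A.incidence.carrier,
      (∀ i j, i < 2 * l + 1 → j < 2 * l + 1 → w i = w j → i = j) ∧
      (∀ i, i + 1 < 2 * l + 1 → A.IncAdj (w i) (w (i + 1))) ∧ ∃ a, w 0 = A.elt a := by
    have hinj : ∀ i j (hi : i < p.length) (hj : j < p.length), p[i] = p[j] → i = j :=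
      fun i j hi hj h => (List.Nodup.getElem_inj_iff hp.1).1 h
    have hch : ∀ i (hi : i + 1 < p.length), A.IncAdj p[i] p[i + 1] :=
      fun i hi => List.isChain_iff_getElem.1 hp.2 i hi
    have hget : ∀ i (hi : i < p.length), p.getD i p[0] = p[i] := fun i hi => by simp [hi]
    rcases FinStr.elt_or_tup p[0] with ⟨a, ha⟩ | ⟨c, hc⟩
    · refine ⟨fun i => p.getD i p[0], fun i j hi hj h => ?_, fun i hi => ?_, a, ?_⟩
      · dsimp only at h
        rw [hget i (by omega), hget j (by omega)] at h
        exact hinj _ _ _ _ h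
      · dsimp only
        rw [hget i (by omega), hget (i + 1) (by omega)]
        exact hch _ _
      · dsimp only
        rw [hget 0 (by omega), ha]
    · refine ⟨fun i => p.getD (i + 1) p[0], fun i j hi hj h => ?_, fun i hi => ?_, ?_⟩
      · dsimp only at h
        rw [hget (i + 1) (by omega), hget (j + 1) (by omega)] at h
        exact Nat.succ_injective (hinj _ _ _ _ h)
      · dsimp only
        rw [hget (i + 1) (by omega), hget (i + 1 + 1) (by omega)]
        exact hch _ _
      · dsimp only
        rw [hget (0 + 1) (by omega)]
        obtain ⟨q, ⟨a, d, h, h', -⟩ | ⟨a, d, h, h', -⟩⟩ := hch 0 (by omega)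
        · exact (FinStr.elt_ne_tup (h.symm.trans hc)).elim
        · exact ⟨a, h⟩
  have hstep : ∀ x y, A.IncAdj x y → ∀ a, x = A.elt a →
      ∃ c p, y = A.tup c ∧ A.IncAt p (A.elt a) (A.tup c) := by
    rintro _ y ⟨p, h⟩ a rfl
    rcases h with h | h
    · obtain ⟨a', c, -, rfl, -⟩ := id h
      exact ⟨c, p, rfl, h⟩
    · obtain ⟨a', c, rfl, h', -⟩ := h
      exact (FinStr.elt_ne_tup h').elim
  have hstep' : ∀ x y, A.IncAdj x y → ∀ c, x = A.tup c →
      ∃ a p, y = A.elt a ∧ A.IncAt p (A.elt a) (A.tup c) := by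
    rintro _ y ⟨p, h⟩ c rfl
    rcases h with h | h
    · obtain ⟨a, c', h', rfl, -⟩ := h
      exact (FinStr.elt_ne_tup h'.symm).elim
    · obtain ⟨a, c', rfl, -, -⟩ := id h
      exact ⟨a, p, rfl, h⟩
  have helt : ∀ i, i ≤ l → ∃ a, w (2 * i) = A.elt a := by
    intro i
    induction i with
    | zero => exact fun _ => h0
    | succ i ih =>
      intro hi
      obtain ⟨a, ha⟩ := ih (by omega)
      obtain ⟨c, -, hc, -⟩ := hstep _ _ (hadj (2 * i) (by omega)) a ha
      obtain ⟨a', -, ha', -⟩ := hstep' _ _ (hadj (2 * i + 1) (by omega)) c hc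
      exact ⟨a', ha'⟩
  choose a ha using fun i : Fin (l + 1) => helt i (by omega)
  choose c p₁ hc hp₁ using fun i : Fin l =>
    hstep _ _ (hadj (2 * i) (by omega)) _ (ha i.castSucc)
  choose a' p₂ ha' hp₂ using fun i : Fin l =>
    hstep' _ _ (hadj (2 * i + 1) (by omega)) _ (hc i)
  have hp₂' : ∀ i : Fin l, A.IncAt (p₂ i) (A.elt (a i.succ)) (A.tup (c i)) := by
    intro i
    rw [← ha i.succ]
    have := hp₂ i
    rwa [← ha' i] at this
  refine ⟨a, c, fun b i => bif b then ⟨p₂ i, (hp₂' i).position⟩ else ⟨p₁ i, (hp₁ i).position⟩,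
    fun i j h => ?_, fun i j h => ?_, fun b i => ?_⟩
  · have := hw (2 * i) (2 * j) (by omega) (by omega) (by rw [ha, ha, h])
    exact Fin.ext (by omega)
  · have := hw (2 * i + 1) (2 * j + 1) (by omega) (by omega) (by rw [hc, hc, h])
    exact Fin.ext (by omega)
  · cases b
    · exact hp₁ i
    · exact hp₂' i

/-- If the incidence graphs of the members of `C` have arbitrarily long simple paths, then all
paths can be obtained from `C`. -/
theorem pathClass_belowIn [Finite L.Symbols] (C : Set (FinStr L))
    (h : ∀ d : ℕ, ∃ A ∈ C, ∃ p : List A.incidence.carrier,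
      IsSimplePath A.IncAdj p ∧ d ≤ p.length) :
    BelowIn pathClass C := by
  refine ⟨PathInterpretation.transduction (L := L) (Finite.equivFin _), ?_⟩
  rintro _ ⟨_, ⟨l, rfl⟩, rfl⟩
  obtain ⟨A, hA, p, hp, hl⟩ := h (2 * l + 2)
  obtain ⟨a, c, pos, ha, hc, hpos⟩ := exists_alternating_path A l p hp hl
  exact ⟨A.incidence, ⟨A, hA, rfl⟩, PathInterpretation.maps _ a c pos ha hc hpos⟩

end

/-! ### Reachability in directed graphs -/

section

lemma zero_position_graph : ∃ n, 0 < n ∧ Nonempty (FirstOrder.Language.graph.Relations n) :=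
  ⟨2, by omega, ⟨FirstOrder.Language.adj⟩⟩

lemma one_position_graph : ∃ n, 1 < n ∧ Nonempty (FirstOrder.Language.graph.Relations n) :=
  ⟨2, by omega, ⟨FirstOrder.Language.adj⟩⟩

/-- There is a directed path from `X_i` to `X_j`. -/
def reachFormula (m k : ℕ) {n : ℕ} (i j : Fin n) :
    MSO (copyLang (expLang (incLang FirstOrder.Language.graph) m) k) n :=
  -- Reachability as membership in every closed set: a set is closed if it passes from a vertex to
  -- the edges leaving it (position 0) and from an edge to its head (position 1).
  .all <| .imp (.and (.sub i.castSucc (Fin.last n)) <| .allElt <| .allElt <|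
    .imp (.and (.sub (Fin.last (n + 1)).castSucc (Fin.last n).castSucc.castSucc)
        (.or (.bin (baseSym m k (incSym zero_position_graph))
            (Fin.last (n + 1)).castSucc (Fin.last (n + 2)))
          (.bin (baseSym m k (incSym one_position_graph))
            (Fin.last (n + 2)) (Fin.last (n + 1)).castSucc)))
      (.sub (Fin.last (n + 2)) (Fin.last n).castSucc.castSucc))
    (.sub j.castSucc (Fin.last n))

variable {V : Type} [Finite V] {edg : V → V → Prop} {m k : ℕ}
  (Q : Fin m → Set (digraph V edg).incidence.carrier)

lemma realize_reachFormula {n : ℕ} (W : Fin n → Set ((digraph V edg).incidence.carrier × Fin k))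
    (i j : Fin n) (s : Fin k) (u v : V) (hi : W i = {(vertexPoint edg u, s)})
    (hj : W j = {(vertexPoint edg v, s)}) :
    CopyRealize (digraph V edg).incidence Q W (reachFormula m k i j) ↔
      Relation.ReflTransGen edg u v := by
  simp only [reachFormula, CopyRealize.all, CopyRealize.imp, CopyRealize.and, CopyRealize.sub,
    CopyRealize.allElt, CopyRealize.or, CopyRealize.inc, Fin.snoc_castSucc, Fin.snoc_last,
    Set.mem_singleton_iff, exists_eq_left, Set.singleton_subset_iff, hi, hj, incAt_zero_iff,
    incAt_one_iff]
  constructor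
  · intro h
    -- The least closed set: the reachable vertices, together with the edges that leave them.
    have := h {x | (∃ w, x.1 = vertexPoint edg w ∧ Relation.ReflTransGen edg u w) ∨
      ∃ w w', ∃ e : edg w w', x.1 = edgePoint e ∧ Relation.ReflTransGen edg u w}
      ⟨.inl ⟨u, rfl, .refl⟩, ?_⟩
    · rcases this with ⟨w, hw, h⟩ | ⟨w, w', e, h, -⟩
      · rwa [vertexPoint_inj.1 hw]
      · exact (vertexPoint_ne_edgePoint h).elim
    · rintro ⟨x, s⟩ ⟨y, t⟩ ⟨hx, ⟨-, w, w', e, rfl, rfl⟩ | ⟨-, w, w', e, rfl, rfl⟩⟩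
      · rcases hx with ⟨w₁, hw, h⟩ | ⟨w₁, w₂, e', h, -⟩
        · rw [← vertexPoint_inj.1 hw] at h
          exact .inr ⟨w, w', e, rfl, h⟩
        · exact (vertexPoint_ne_edgePoint h).elim
      · rcases hx with ⟨w₁, hw, h⟩ | ⟨w₁, w₂, e', h', h⟩
        · exact (vertexPoint_ne_edgePoint (h := e) hw.symm).elim
        · rw [← ((edgePoint_inj (h := e)).1 h').1] at h
          exact .inl ⟨w', rfl, h.tail e⟩
  · rintro h X ⟨hu, hX⟩
    clear hj
    induction h with
    | refl => exact hu
    | tail _ e ih =>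
      have := hX (_, s) (edgePoint e, s) ⟨ih, .inl ⟨rfl, _, _, e, rfl, rfl⟩⟩
      exact hX _ (_, s) ⟨this, .inr ⟨rfl, _, _, e, rfl, rfl⟩⟩

end

/-! ### Interpreting structures of bounded tree-depth in trees -/

abbrev treeEdge (m n : ℕ) (x y : {x : List (Fin m) // x.length < n}) : Prop :=
  ∃ d, y.1 = x.1 ++ [d]

lemma reflTransGen_treeEdge {m n : ℕ} {x y : {x : List (Fin m) // x.length < n}} :
    Relation.ReflTransGen (treeEdge m n) x y ↔ x.1 <+: y.1 := by
  constructor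
  · intro h
    induction h with
    | refl => exact List.prefix_rfl
    | tail _ e ih =>
      obtain ⟨d, hd⟩ := e
      rw [hd]
      exact ih.trans (List.prefix_append _ _)
  · obtain ⟨x, hx⟩ := x
    obtain ⟨y, hy⟩ := y
    rintro ⟨t, rfl⟩
    induction t using List.reverseRecOn with
    | nil => simpa using Relation.ReflTransGen.refl
    | append_singleton t d ih =>
      have h : (x ++ t).length < n := by
        simp only [List.length_append, List.length_singleton] at hy ⊢
        omega
      exact (ih h).tail ⟨d, by simp⟩

section

variable {L : FirstOrder.Language.{0, 0}} [L.IsRelational]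

namespace TreeInterpretation

/-- The parameters of the interpretation: the domain, the levels of the tree, the unary relations,
and the incidences of an element with its ancestors. -/
abbrev Param (L : FirstOrder.Language.{0, 0}) (d : ℕ) : Type :=
  Option (Fin (d + 1) ⊕ (Σ n, L.Relations n) ⊕ Bool × Position L × Fin (d + 1))

variable {d M : ℕ} (q : Param L d ≃ Fin M)

abbrev paramFormula {n : ℕ} (j : Param L d) (i : Fin n) :
    MSO (copyLang (expLang (incLang FirstOrder.Language.graph) M) 1) n :=
  .un (paramSym _ 1 (q j)) i

/-- Incident points are comparable in the forest, so the lower one can carry the level `e` of the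
upper one. The flag is `false` if the element is above the tuple and `true` if the tuple is above
the element. -/
noncomputable def incFormula (p : Position L) :
    MSO (copyLang (expLang (incLang FirstOrder.Language.graph) M) 1) 2 :=
  .bigOr fun e : Fin (d + 1) =>
    .or (.and (.and (paramFormula q (some (.inl e)) 0)
        (paramFormula q (some (.inr (.inr (false, p, e)))) 1)) (reachFormula M 1 0 1))
      (.and (.and (paramFormula q (some (.inl e)) 1)
        (paramFormula q (some (.inr (.inr (true, p, e)))) 0)) (reachFormula M 1 1 0))

noncomputable def transduction :
    Transduction (incLang FirstOrder.Language.graph) (incLang L) where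
  k := 1
  one_le_k := le_rfl
  m := M
  base :=
    { χ := .tru
      δ := paramFormula q none 0
      φ := fun R => match R with
        | .P R => paramFormula q (some (.inr (.inl ⟨_, R⟩))) 0
        | .inc p h => incFormula q ⟨p, h⟩ }

variable [Finite L.Symbols] (A : FinStr L) (f : A.incidence.carrier → List A.incidence.carrier)
  (hf : ∀ x, (f x).length ≤ d)

/-- The tree vertex representing `x`. -/
noncomputable def vertex (x : A.incidence.carrier) :
    (digraph _ (treeEdge (Nat.card A.incidence.carrier) (d + 1))).incidence.carrier :=
  vertexPoint _ ⟨(f x).map (Finite.equivFin _), by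
    rw [List.length_map]; exact Nat.lt_succ_of_le (hf x)⟩

/-- The elements satisfying a parameter. -/
def paramSet : Param L d → Set A.incidence.carrier
  | none => Set.univ
  | some (.inl e) => {x | (f x).length = e}
  | some (.inr (.inl R)) => {x | RelMap (L := incLang L) (IncRel.P R.2) ![x]}
  | some (.inr (.inr (false, p, e))) => {y | ∃ x, f x <+: f y ∧ (f x).length = e ∧ A.IncAt p x y}
  | some (.inr (.inr (true, p, e))) => {x | ∃ y, f y <+: f x ∧ (f y).length = e ∧ A.IncAt p x y}

noncomputable def params (i : Fin M) :
    Set (digraph _ (treeEdge (Nat.card A.incidence.carrier) (d + 1))).incidence.carrier :=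
  vertex A f hf '' paramSet A f (q.symm i)

variable (hinj : Function.Injective f)

include hinj in
lemma vertex_injective : Function.Injective (vertex A f hf) := by
  intro x y h
  have h := congrArg Subtype.val (vertexPoint_inj.1 h)
  exact hinj (List.map_injective_iff.2 (Finite.equivFin _).injective h)

lemma realize_paramFormula {n : ℕ} (W) (i : Fin n) (j : Param L d) :
    CopyRealize (digraph _ (treeEdge (Nat.card A.incidence.carrier) (d + 1))).incidence
      (params q A f hf) W (paramFormula q j i) ↔
      ∃ y ∈ W i, ∃ x ∈ paramSet A f j, vertex A f hf x = y.1 := by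
  rw [paramFormula, CopyRealize.param, params, q.symm_apply_apply]
  rfl

include hinj in
lemma realize_paramFormula_vertex {n : ℕ} (W) (i : Fin n) (j : Param L d)
    (x : A.incidence.carrier) (hW : W i = {(vertex A f hf x, 0)}) :
    CopyRealize (digraph _ (treeEdge (Nat.card A.incidence.carrier) (d + 1))).incidence
      (params q A f hf) W (paramFormula q j i) ↔ x ∈ paramSet A f j := by
  rw [realize_paramFormula, hW]
  simp only [Set.mem_singleton_iff, exists_eq_left]
  exact ⟨fun ⟨y, hy, h⟩ => vertex_injective A f hf hinj h ▸ hy, fun h => ⟨x, h, rfl⟩⟩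

lemma realize_reachFormula_vertex {n : ℕ} (W) (i j : Fin n)
    (x y : A.incidence.carrier) (hi : W i = {(vertex A f hf x, 0)})
    (hj : W j = {(vertex A f hf y, 0)}) :
    CopyRealize (digraph _ (treeEdge (Nat.card A.incidence.carrier) (d + 1))).incidence
      (params q A f hf) W (reachFormula M 1 i j) ↔ f x <+: f y := by
  rw [realize_reachFormula _ W i j 0 _ _ hi hj, reflTransGen_treeEdge]
  exact List.prefix_map_iff_of_injective (Finite.equivFin _).injective

include hinj in
-- A stored level identifies a unique ancestor, since two prefixes of one list with equal length
-- coincide and `f` is injective. Conversely, `hadj` makes every incidence visible in one of the two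
-- directions.
lemma realize_incFormula (hadj : ∀ x y, A.IncAdj x y → f x <+: f y ∨ f y <+: f x)
    (p : Position L) (x y : A.incidence.carrier) :
    CopyRealize (digraph _ (treeEdge (Nat.card A.incidence.carrier) (d + 1))).incidence
      (params q A f hf) ![{(vertex A f hf x, 0)}, {(vertex A f hf y, 0)}] (incFormula q p) ↔
      A.IncAt p x y := by
  simp only [incFormula, CopyRealize.bigOr, CopyRealize.or, CopyRealize.and]
  have anc : ∀ {x x' y}, f x <+: f y → f x' <+: f y → (f x').length = (f x).length → x = x' :=
    fun h h' hl => hinj ((List.prefix_of_prefix_length_le h h' hl.ge).eq_of_length hl.symm)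
  have h0 := realize_paramFormula_vertex q A f hf hinj
    ![{(vertex A f hf x, 0)}, {(vertex A f hf y, 0)}] 0 (x := x) (hW := rfl)
  have h1 := realize_paramFormula_vertex q A f hf hinj
    ![{(vertex A f hf x, 0)}, {(vertex A f hf y, 0)}] 1 (x := y) (hW := rfl)
  have h2 := realize_reachFormula_vertex q A f hf
    ![{(vertex A f hf x, 0)}, {(vertex A f hf y, 0)}] 0 1 x y rfl rfl
  have h3 := realize_reachFormula_vertex q A f hf
    ![{(vertex A f hf x, 0)}, {(vertex A f hf y, 0)}] 1 0 y x rfl rfl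
  simp only [h0, h1, h2, h3]
  constructor
  · rintro ⟨e, ⟨⟨hx, x', hx', hl, h⟩, hxy⟩ | ⟨⟨hy, y', hy', hl, h⟩, hxy⟩⟩
    · rwa [anc hxy hx' (hl.trans hx.symm)]
    · rwa [anc hxy hy' (hl.trans hy.symm)]
  · intro h
    rcases hadj x y ⟨p, .inl h⟩ with h' | h'
    · exact ⟨⟨_, Nat.lt_succ_of_le (hf x)⟩, .inl ⟨⟨rfl, x, h', rfl, h⟩, h'⟩⟩
    · exact ⟨⟨_, Nat.lt_succ_of_le (hf y)⟩, .inr ⟨⟨rfl, y, h', rfl, h⟩, h'⟩⟩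

include hf hinj in
theorem maps (hadj : ∀ x y, A.IncAdj x y → f x <+: f y ∨ f y <+: f x) :
    (transduction q).Maps (completeTree (Nat.card A.incidence.carrier) (d + 1)).incidence
      A.incidence := by
  have hdom : ∀ y, CopyRealize
      (digraph _ (treeEdge (Nat.card A.incidence.carrier) (d + 1))).incidence
      (params q A f hf) ![{y}] (paramFormula q none 0) ↔ ∃ x, (vertex A f hf x, 0) = y := by
    rintro ⟨y, s⟩
    rw [realize_paramFormula]
    simp only [Matrix.cons_val, Set.mem_singleton_iff, exists_eq_left]
    constructor
    · rintro ⟨x, -, rfl⟩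
      exact ⟨x, Prod.ext rfl (Subsingleton.elim _ _)⟩
    · rintro ⟨x, hx⟩
      exact ⟨x, trivial, congrArg Prod.fst hx⟩
  refine maps_of_equiv (transduction q)
    (digraph _ (treeEdge (Nat.card A.incidence.carrier) (d + 1))).incidence _
    (params q A f hf) id Function.bijective_id
    (fun x => ((vertex A f hf x, (0 : Fin 1)) : _ × Fin 1))
    (fun x y h => vertex_injective A f hf hinj (congrArg Prod.fst h))
    (fun V => CopyRealize.tru _ _ V) hdom ?_
  rintro n (⟨R⟩ | ⟨p, hp⟩) x
  · refine (realize_paramFormula_vertex q A f hf hinj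
      (fun i => {(vertex A f hf (x i), 0)}) 0 (some (.inr (.inl ⟨_, R⟩))) (x 0) rfl).trans ?_
    rfl
  · have hV : (fun i => {(vertex A f hf (x i), 0)} : Fin 2 → Set
        ((digraph _ (treeEdge (Nat.card A.incidence.carrier) (d + 1))).incidence.carrier × Fin 1)) =
        ![{(vertex A f hf (x 0), 0)}, {(vertex A f hf (x 1), 0)}] := by
      funext i; fin_cases i <;> rfl
    have h := realize_incFormula q A f hf hinj hadj ⟨p, hp⟩ (x 0) (x 1)
    rw [← hV] at h
    exact h

end TreeInterpretation

/-- If simple paths in the incidence graphs of the members of `C` have bounded length, then `C` can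
be obtained from trees of bounded height. -/
theorem belowIn_treeClass [Finite L.Symbols] (C : Set (FinStr L)) (d : ℕ)
    (h : ∀ A ∈ C, ∀ p : List A.incidence.carrier, IsSimplePath A.IncAdj p → p.length ≤ d) :
    BelowIn C (treeClass (d + 1)) := by
  have := finite_sigma_relations (L := L)
  refine ⟨TreeInterpretation.transduction (L := L) (d := d) (Finite.equivFin _), ?_⟩
  rintro _ ⟨A, hA, rfl⟩
  obtain ⟨f, hf, hlast, hadj⟩ := exists_normal_forest A.IncAdj fun _ _ => FinStr.IncAdj.symm
  refine ⟨_, ⟨_, ⟨_, rfl⟩, rfl⟩, TreeInterpretation.maps _ A f (fun x => h A hA _ (hf x))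
    (fun x y hxy => ?_) hadj⟩
  have := hlast x
  rw [hxy, hlast y] at this
  exact (Option.some.inj this).symm

end

/-! ### Types of bounded quantifier rank -/

section

/-- Quantifier-free information about `n` sets in a structure with a family of constants. -/
abbrev AtomType (L : FirstOrder.Language.{0, 0}) (ι : Type) (n : ℕ) : Type :=
  (Fin n → Fin n → Prop) × (∀ R : (Σ k, L.Relations k), (Fin R.1 → Fin n) → Prop) ×
    (ι → Fin n → Prop)

/-- Types of quantifier rank `r` with `n` free set variables. -/
def RankType (L : FirstOrder.Language.{0, 0}) (ι : Type) : ℕ → ℕ → Type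
  | 0, n => AtomType L ι n
  | r + 1, n => Set (RankType L ι r (n + 1))

lemma finite_rankType {L : FirstOrder.Language.{0, 0}} [Finite (Σ k, L.Relations k)] {ι : Type}
    [Finite ι] : ∀ r n, Finite (RankType L ι r n)
  | 0, n => inferInstanceAs (Finite (AtomType L ι n))
  | r + 1, n => by
    have := finite_rankType (L := L) (ι := ι) r (n + 1)
    exact inferInstanceAs (Finite (Set (RankType L ι r (n + 1))))

/-- The quantifier rank. -/
def MSO.rank {L : FirstOrder.Language.{0, 0}} : {n : ℕ} → MSO L n → ℕ
  | _, .sub _ _ => 0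
  | _, .rel _ _ => 0
  | _, .neg φ => φ.rank
  | _, .and φ ψ => max φ.rank ψ.rank
  | _, .ex φ => φ.rank + 1

variable {L : FirstOrder.Language.{0, 0}} {M ι : Type} [L.Structure M] (c : ι → Set M)

/-- The quantifier-free type of `V` in the substructure induced by `P`. -/
def atomType (P : Set M) {n : ℕ} (V : Fin n → Set M) : AtomType L ι n :=
  (fun i j => V i ∩ P ⊆ V j ∩ P, fun R Z => ∃ a, (∀ i, a i ∈ V (Z i) ∩ P) ∧ RelMap R.2 a,
    fun t i => (V i ∩ P ∩ c t).Nonempty)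

variable (L) in
/-- The type of quantifier rank `r` of `V` in the substructure induced by `P`. -/
def rankType (P : Set M) : (r : ℕ) → {n : ℕ} → (Fin n → Set M) → RankType L ι r n
  | 0, _, V => atomType c P V
  | r + 1, _, V => Set.range fun X : Set M => rankType P r (Fin.snoc (α := fun _ => Set M) V X)

variable {c}

lemma atomType_eq_of_snoc {P P' : Set M} {n : ℕ} {V V' : Fin n → Set M} {X X' : Set M}
    (h : (atomType c P (Fin.snoc (α := fun _ => Set M) V X) : AtomType L ι (n + 1)) =
      atomType c P' (Fin.snoc (α := fun _ => Set M) V' X')) :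
    (atomType c P V : AtomType L ι n) = atomType c P' V' := by
  simp only [atomType, Prod.mk.injEq] at h ⊢
  obtain ⟨h₁, h₂, h₃⟩ := h
  refine ⟨funext fun i => funext fun j => ?_, funext fun R => funext fun Z => ?_,
    funext fun t => funext fun i => ?_⟩
  · simpa using congrFun (congrFun h₁ i.castSucc) j.castSucc
  · simpa using congrFun (congrFun h₂ R) fun i => (Z i).castSucc
  · simpa using congrFun (congrFun h₃ t) i.castSucc

lemma exists_rankType_snoc_eq {P P' : Set M} {r n : ℕ} {V V' : Fin n → Set M}
    (h : rankType L c P (r + 1) V = rankType L c P' (r + 1) V') (X : Set M) :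
    ∃ X' : Set M, rankType L c P r (Fin.snoc (α := fun _ => Set M) V X) =
      rankType L c P' r (Fin.snoc (α := fun _ => Set M) V' X') := by
  have h : (Set.range fun X => rankType L c P r (Fin.snoc (α := fun _ => Set M) V X)) =
      Set.range fun X => rankType L c P' r (Fin.snoc (α := fun _ => Set M) V' X) := h
  obtain ⟨X', hX'⟩ := h ▸ Set.mem_range_self X
  exact ⟨X', hX'.symm⟩

lemma atomType_eq_of_rankType_eq {P P' : Set M} : ∀ {r n : ℕ} {V V' : Fin n → Set M},
    rankType L c P r V = rankType L c P' r V' →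
      (atomType c P V : AtomType L ι n) = atomType c P' V'
  | 0, _, _, _, h => h
  | _ + 1, _, _, _, h => by
    obtain ⟨X', hX'⟩ := exists_rankType_snoc_eq h ∅
    exact atomType_eq_of_snoc (atomType_eq_of_rankType_eq hX')

theorem realize_iff_of_rankType_eq {n : ℕ} (φ : MSO L n) : ∀ {r : ℕ}, φ.rank ≤ r →
    ∀ {V V' : Fin n → Set M}, rankType L c Set.univ r V = rankType L c Set.univ r V' →
      (φ.Realize V ↔ φ.Realize V') := by
  induction φ with
  | sub i j =>
    intro r _ V V' h
    have h := congrFun (congrFun (congrArg Prod.fst (atomType_eq_of_rankType_eq h)) i) j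
    simp only [atomType, Set.inter_univ] at h
    exact iff_of_eq h
  | rel R Z =>
    intro r _ V V' h
    have h := congrFun (congrFun (congrArg (fun t => t.2.1) (atomType_eq_of_rankType_eq h))
      ⟨_, R⟩) Z
    simp only [atomType, Set.inter_univ] at h
    exact iff_of_eq h
  | neg φ ih => exact fun hr _ _ h => not_congr (ih hr h)
  | and φ ψ ihφ ihψ =>
    exact fun hr _ _ h => and_congr (ihφ (le_trans (le_max_left _ _) hr) h)
      (ihψ (le_trans (le_max_right _ _) hr) h)
  | ex φ ih =>
    intro r hr V V' h
    obtain ⟨r, rfl⟩ : ∃ r', r = r' + 1 := ⟨r - 1, by simp only [MSO.rank] at hr; omega⟩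
    have hr : φ.rank ≤ r := Nat.le_of_succ_le_succ hr
    constructor
    · rintro ⟨X, hX⟩
      obtain ⟨X', h'⟩ := exists_rankType_snoc_eq h X
      exact ⟨X', (ih hr h').1 hX⟩
    · rintro ⟨X, hX⟩
      obtain ⟨X', h'⟩ := exists_rankType_snoc_eq h.symm X
      exact ⟨X', (ih hr h').1 hX⟩

lemma rankType_congr {P : Set M} : ∀ {r n : ℕ} {V V' : Fin n → Set M},
    (∀ i, V i ∩ P = V' i ∩ P) → rankType L c P r V = rankType L c P r V'
  | 0, n, V, V', h => by
    simp only [rankType, atomType, h]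
    rfl
  | r + 1, n, V, V', h => by
    refine congrArg Set.range (funext fun X => rankType_congr fun i => ?_)
    refine Fin.lastCases ?_ (fun i => ?_) i
    · simp
    · simpa using h i

/-- Types of structures that are glued along a set of constants. -/
theorem rankType_univ_eq_of_perm {I : Type} [Nonempty I] (S : Set M) (P : I → Set M)
    (hcover : ∀ a, ∃ i, a ∈ P i)
    (hrel : ∀ (k : ℕ) (R : L.Relations k) (a : Fin k → M), RelMap R a → ∃ i, ∀ j, a j ∈ P i)
    (hS : ∀ i, S ⊆ P i) (hinter : ∀ i j a, i ≠ j → a ∈ P i → a ∈ P j → a ∈ S)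
    (hc : ∀ a ∈ S, ∃ t, c t = {a}) : ∀ {r n : ℕ} {V V' : Fin n → Set M} (π : Equiv.Perm I),
    (∀ i, rankType L c (P i) r V = rankType L c (P (π i)) r V') →
      rankType L c Set.univ r V = rankType L c Set.univ r V'
  | 0, n, V, V', π, h => by
    -- Inclusions are conjunctions over the parts; relational atoms and constants are disjunctions,
    -- since every related tuple lies inside one part. Both are invariant under permuting the parts.
    have key : ∀ (V : Fin n → Set M), (atomType c Set.univ V : AtomType L ι n) =
        (fun i j => ∀ l, (atomType c (P l) V : AtomType L ι n).1 i j,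
          fun R Z => ∃ l, (atomType c (P l) V : AtomType L ι n).2.1 R Z,
          fun t i => ∃ l, (atomType c (P l) V : AtomType L ι n).2.2 t i) := by
      intro V
      refine Prod.ext (funext fun i => funext fun j => propext ?_) (Prod.ext
        (funext fun R => funext fun Z => propext ?_) (funext fun t => funext fun i => propext ?_))
      · constructor
        · exact fun h l a ha => ⟨(h ⟨ha.1, trivial⟩).1, ha.2⟩
        · intro h a ha
          obtain ⟨l, hl⟩ := hcover a
          exact ⟨(h l ⟨ha.1, hl⟩).1, trivial⟩
      · constructor
        · rintro ⟨a, ha, hR⟩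
          obtain ⟨l, hl⟩ := hrel _ _ a hR
          exact ⟨l, a, fun i => ⟨(ha i).1, hl i⟩, hR⟩
        · rintro ⟨l, a, ha, hR⟩
          exact ⟨a, fun i => ⟨(ha i).1, trivial⟩, hR⟩
      · constructor
        · rintro ⟨a, ha, hat⟩
          obtain ⟨l, hl⟩ := hcover a
          exact ⟨l, a, ⟨ha.1, hl⟩, hat⟩
        · rintro ⟨l, a, ha, hat⟩
          exact ⟨a, ⟨ha.1, trivial⟩, hat⟩
    refine (key V).trans (Eq.trans ?_ (key V').symm)
    have h : ∀ l, (atomType c (P l) V : AtomType L ι n) = atomType c (P (π l)) V' := h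
    simp only [h]
    refine Prod.ext (funext fun i => funext fun j => propext ?_) (Prod.ext
      (funext fun R => funext fun Z => propext ?_) (funext fun t => funext fun i => propext ?_))
    · exact π.forall_congr_right (q := fun l => (atomType c (P l) V' : AtomType L ι n).1 i j)
    · exact π.exists_congr_right (q := fun l => (atomType c (P l) V' : AtomType L ι n).2.1 R Z)
    · exact π.exists_congr_right (q := fun l => (atomType c (P l) V' : AtomType L ι n).2.2 t i)
  | r + 1, n, V, V', π, h => by
    have key : ∀ (V V' : Fin n → Set M) (π : Equiv.Perm I),
        (∀ i, rankType L c (P i) (r + 1) V = rankType L c (P (π i)) (r + 1) V') →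
        (Set.range fun X => rankType L c Set.univ r (Fin.snoc (α := fun _ => Set M) V X)) ⊆
          Set.range fun X => rankType L c Set.univ r (Fin.snoc (α := fun _ => Set M) V' X) := by
      rintro V V' π h _ ⟨X, rfl⟩
      -- Each part answers the move `X` separately, and the answers are glued along `π`.
      choose X' hX' using fun i => exists_rankType_snoc_eq (h i) X
      refine ⟨{a | ∃ i, a ∈ X' i ∧ a ∈ P (π i)}, ?_⟩
      refine (rankType_univ_eq_of_perm S P hcover hrel hS hinter hc π fun i =>
        (hX' i).trans (rankType_congr fun j => ?_)).symm
      refine Fin.lastCases ?_ (fun j => by simp) j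
      simp only [Fin.snoc_last]
      -- The glued answers are consistent: parts overlap only in `S`, whose points are named by
      -- constants, so every answer agrees with `X` there.
      have hmem : ∀ i, ∀ a ∈ S, (a ∈ X' i ↔ a ∈ X) := by
        intro i a ha
        obtain ⟨t, ht⟩ := hc a ha
        have := congrFun (congrFun (congrArg (fun t => t.2.2)
          (atomType_eq_of_rankType_eq (hX' i))) t) (Fin.last n)
        have h₁ : ∀ (X : Set M) i, a ∈ X ↔ (X ∩ P i ∩ c t).Nonempty := by
          intro X i
          rw [ht]
          constructor
          · exact fun h => ⟨a, ⟨h, hS i ha⟩, rfl⟩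
          · rintro ⟨b, ⟨hb, -⟩, rfl⟩
            exact hb
        simp only [atomType, Fin.snoc_last] at this
        rw [h₁ X i, h₁ (X' i) (π i), this]
      ext a
      constructor
      · exact fun ha => ⟨⟨i, ha.1, ha.2⟩, ha.2⟩
      · rintro ⟨⟨i', ha, hi'⟩, hi⟩
        refine ⟨?_, hi⟩
        by_cases hii : i = i'
        · exact hii ▸ ha
        · have haS := hinter _ _ a (π.injective.ne hii) hi hi'
          rwa [hmem i a haS, ← hmem i' a haS]
    refine Set.Subset.antisymm (key V V' π h) (key V' V π.symm fun i => ?_)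
    have := h (π.symm i)
    rw [π.apply_symm_apply] at this
    exact this.symm

/-- Whether a formula holds for two elements of different parts depends only on types. -/
theorem rankType_pair_eq {I : Type} [Nonempty I] (S : Set M) (P : I → Set M)
    (hcover : ∀ a, ∃ i, a ∈ P i)
    (hrel : ∀ (k : ℕ) (R : L.Relations k) (a : Fin k → M), RelMap R a → ∃ i, ∀ j, a j ∈ P i)
    (hS : ∀ i, S ⊆ P i) (hinter : ∀ i j a, i ≠ j → a ∈ P i → a ∈ P j → a ∈ S)
    (hc : ∀ a ∈ S, ∃ t, c t = {a}) {r : ℕ} {x x' y y' : M} {i i' j j' : I}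
    (hx : ∀ l, x ∈ P l ↔ l = i) (hx' : ∀ l, x' ∈ P l ↔ l = i')
    (hy : ∀ l, y ∈ P l ↔ l = j) (hy' : ∀ l, y' ∈ P l ↔ l = j') (hij : i ≠ j) (hij' : i' ≠ j')
    (h₁ : rankType L c (P i) r ![{x}, ∅] = rankType L c (P i') r ![{x'}, ∅])
    (h₁' : rankType L c (P i) r ![∅, ∅] = rankType L c (P i') r ![∅, ∅])
    (h₂ : rankType L c (P j) r ![∅, {y}] = rankType L c (P j') r ![∅, {y'}])
    (h₂' : rankType L c (P j) r ![∅, ∅] = rankType L c (P j') r ![∅, ∅]) :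
    rankType L c Set.univ r ![{x}, {y}] = rankType L c Set.univ r ![{x'}, {y'}] := by
  classical
  let ty : I → RankType L ι r 2 := fun l => rankType L c (P l) r ![∅, ∅]
  have hswap : ∀ a b : I, ty a = ty b → ∀ l, ty (Equiv.swap a b l) = ty l := by
    intro a b h l
    by_cases hla : l = a
    · rw [hla, Equiv.swap_apply_left, h]
    by_cases hlb : l = b
    · rw [hlb, Equiv.swap_apply_right, h]
    rw [Equiv.swap_apply_of_ne_of_ne hla hlb]
  -- Two transpositions suffice. The second fixes `i'`, and both exchange only parts with equal
  -- types, so all other parts are sent to parts of the same type.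
  obtain ⟨π, hπi, hπj, hπ⟩ : ∃ π : Equiv.Perm I, π i = i' ∧ π j = j' ∧ ∀ l, ty (π l) = ty l := by
    have hne : Equiv.swap i i' j ≠ i' := fun h =>
      hij ((Equiv.swap i i').injective ((Equiv.swap_apply_left i i').trans h.symm))
    refine ⟨(Equiv.swap i i').trans (Equiv.swap (Equiv.swap i i' j) j'), ?_, ?_, fun l => ?_⟩
    · rw [Equiv.trans_apply, Equiv.swap_apply_left, Equiv.swap_apply_of_ne_of_ne hne.symm hij']
    · rw [Equiv.trans_apply, Equiv.swap_apply_left]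
    · rw [Equiv.trans_apply, hswap _ _ ((hswap _ _ h₁' _).trans h₂'), hswap _ _ h₁']
  refine rankType_univ_eq_of_perm S P hcover hrel hS hinter hc π fun l => ?_
  have hsing : ∀ {z : M} {i l : I}, (∀ l, z ∈ P l ↔ l = i) → l ≠ i →
      ({z} : Set M) ∩ P l = ∅ ∩ P l := by
    intro z i l hz hl
    rw [Set.empty_inter, Set.singleton_inter_eq_empty, hz]
    exact hl
  by_cases hli : l = i
  · subst hli
    rw [hπi]
    refine Eq.trans (rankType_congr fun t => ?_) (h₁.trans (rankType_congr fun t => ?_))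
    · fin_cases t
      · rfl
      · exact hsing hy hij
    · fin_cases t
      · rfl
      · exact (hsing hy' hij').symm
  by_cases hlj : l = j
  · subst hlj
    rw [hπj]
    refine Eq.trans (rankType_congr fun t => ?_) (h₂.trans (rankType_congr fun t => ?_))
    · fin_cases t
      · exact hsing hx hli
      · rfl
    · fin_cases t
      · exact (hsing hx' hij'.symm).symm
      · rfl
  · refine Eq.trans (rankType_congr fun t => ?_) ((hπ l).symm.trans (rankType_congr fun t => ?_))
    · fin_cases t
      · exact hsing hx hli
      · exact hsing hy hlj
    · fin_cases t
      · exact (hsing hx' fun h => hli (π.injective (h.trans hπi.symm))).symm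
      · exact (hsing hy' fun h => hlj (π.injective (h.trans hπj.symm))).symm

end

/-! ### Trees in structures of bounded tree-depth -/

/-- A relation that depends on finitely many colours across different parts and where every `y` has
at most two neighbours is, up to a bounded number of `x`, contained in the parts. -/
lemma exists_cover {α β I K : Type} [DecidableEq α] [Finite K] (E : α → β → Prop)
    (N : β → Finset α) (hN : ∀ y, (N y).card ≤ 2) (hE : ∀ x y, E x y → x ∈ N y)
    (pa : α → I) (pb : β → I) (ca : α → K) (cb : β → K)
    (hcross : ∀ x y x' y', pa x ≠ pb y → pa x' ≠ pb y' → ca x = ca x' → cb y = cb y' →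
      E x y → E x' y') :
    ∃ S : Finset α, S.card ≤ Nat.card (K × K) * 4 ∧ ∀ x y, E x y → pa x = pb y ∨ x ∈ S := by
  have := Fintype.ofFinite K
  -- For a fixed pair of colours one crossing pair `x₀, y₀` nearly suffices: by `hcross`, any
  -- crossing `x` outside the part of `y₀` is related to `y₀`, hence lies in `N y₀`.
  have hone : ∀ t : K × K, ∃ S : Finset α, S.card ≤ 4 ∧
      ∀ x y, ca x = t.1 → cb y = t.2 → E x y → pa x = pb y ∨ x ∈ S := by
    rintro ⟨a, b⟩
    by_cases h₀ : ∃ x y, ca x = a ∧ cb y = b ∧ E x y ∧ pa x ≠ pb y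
    swap
    · exact ⟨∅, by simp, fun x y hx hy h => .inl (by_contra fun h' => h₀ ⟨x, y, hx, hy, h, h'⟩)⟩
    obtain ⟨x₀, y₀, hx₀, hy₀, hE₀, hp₀⟩ := h₀
    by_cases h₁ : ∃ x y, ca x = a ∧ cb y = b ∧ E x y ∧ pa x ≠ pb y ∧ pa x = pb y₀
    -- A crossing `x` inside the part of `y₀` is tested against `y₁` instead, which lies outside
    -- that part because `x₁` lies in it and crosses to `y₁`. This gives the bound `2 + 2`.
    · obtain ⟨x₁, y₁, hx₁, hy₁, hE₁, hp₁, hp₁'⟩ := h₁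
      refine ⟨N y₀ ∪ N y₁, (Finset.card_union_le _ _).trans (add_le_add (hN _) (hN _)),
        fun x y hx hy h => or_iff_not_imp_left.2 fun hp => Finset.mem_union.2 ?_⟩
      by_cases hxp : pa x = pb y₀
      · exact .inr (hE _ _ (hcross x y x y₁ hp (by rwa [hxp, ← hp₁']) rfl (hy.trans hy₁.symm) h))
      · exact .inl (hE _ _ (hcross x y x y₀ hp hxp rfl (hy.trans hy₀.symm) h))
    · refine ⟨N y₀, (hN _).trans (by omega),
        fun x y hx hy h => or_iff_not_imp_left.2 fun hp => ?_⟩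
      have hxp : pa x ≠ pb y₀ := fun hxp => h₁ ⟨x, y, hx, hy, h, hp, hxp⟩
      exact hE _ _ (hcross x y x y₀ hp hxp rfl (hy.trans hy₀.symm) h)
  choose S hS hS' using hone
  refine ⟨Finset.univ.biUnion S, ?_, fun x y h => ?_⟩
  · rw [Nat.card_eq_fintype_card]
    exact Finset.card_biUnion_le_card_mul _ _ _ fun t _ => hS t
  · refine (hS' (ca x, cb y) x y rfl rfl h).imp id fun hx => ?_
    exact Finset.mem_biUnion.2 ⟨_, Finset.mem_univ _, hx⟩

/-- The incidence relation `E` contains the incidence graph of the complete `m`-ary tree of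
height `h`, below the node `s` of the forest `f`. -/
structure IsTreeBelow {M Y : Type} (E : M → M → Prop) (f : M → List Y) (s : List Y) (m h : ℕ)
    (gV : List (Fin m) → M) (gE : List (Fin m) → Fin m → M) : Prop where
  prefV : ∀ u, u.length < h → s <+: f (gV u)
  prefE : ∀ u d, u.length + 1 < h → s <+: f (gE u d)
  injV : ∀ u v, u.length < h → v.length < h → gV u = gV v → u = v
  injE : ∀ u d u' d', u.length + 1 < h → u'.length + 1 < h → gE u d = gE u' d' → u = u'
  inc : ∀ v u d, v.length < h → u.length + 1 < h → (E (gV v) (gE u d) ↔ v = u ∨ v = u ++ [d])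

/-! ### Decomposition at a node of a forest, and descent of definable trees -/

section

variable {L : FirstOrder.Language.{0, 0}} {M Y : Type} [L.Structure M] (f : M → List Y)

/-- The parts into which a structure decomposes at a node `s` of a forest. -/
def forestPart (s : List Y) : Option Y → Set M
  | none => {y | ¬ (s <+: f y ∧ f y ≠ s)}
  | some x => {y | f y <+: s ∨ s ++ [x] <+: f y}

/-- The part containing an element strictly below `s`. -/
def partOf (s : List Y) (y : M) : Option Y := (f y)[s.length]?

variable {f}

lemma partOf_eq_some {s : List Y} {y : M} (h : s <+: f y) (h' : f y ≠ s) :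
    ∃ x, partOf f s y = some x ∧ s ++ [x] <+: f y := by
  obtain ⟨t, ht⟩ := h
  cases t with
  | nil => exact (h' (by simpa using ht.symm)).elim
  | cons x t =>
    refine ⟨x, ?_, ⟨t, by simp [← ht]⟩⟩
    rw [partOf, ← ht]
    simp

lemma partOf_of_prefix {s : List Y} {y : M} {x : Y} (h : s ++ [x] <+: f y) :
    partOf f s y = some x := by
  obtain ⟨t, ht⟩ := h
  rw [partOf, ← ht]
  simp

lemma not_prefix_of_concat_prefix {s l : List Y} {x : Y} (h : s ++ [x] <+: l) : ¬ l <+: s := by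
  intro h'
  have h₁ := h.length_le
  have h₂ := h'.length_le
  simp only [List.length_append, List.length_singleton] at h₁
  omega

lemma mem_forestPart_iff {s : List Y} {y : M} (h : s <+: f y) (h' : f y ≠ s) (l : Option Y) :
    y ∈ forestPart f s l ↔ l = partOf f s y := by
  obtain ⟨x, hx, hpre⟩ := partOf_eq_some h h'
  rw [hx]
  cases l with
  | none => simp [forestPart, h, h']
  | some z =>
    constructor
    · rintro (hz | hz)
      · exact (not_prefix_of_concat_prefix hpre hz).elim
      · rw [← hx, partOf_of_prefix hz]
    · rintro h
      rw [Option.some.inj h]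
      exact .inr hpre

lemma exists_mem_forestPart (s : List Y) (y : M) : ∃ l, y ∈ forestPart f s l := by
  by_cases h : s <+: f y ∧ f y ≠ s
  · exact ⟨_, (mem_forestPart_iff h.1 h.2 _).2 rfl⟩
  · exact ⟨none, h⟩

lemma apex_subset_forestPart (s : List Y) (l : Option Y) :
    {y | f y <+: s} ⊆ forestPart f s l := by
  intro y hy
  cases l with
  | none => exact fun h => h.2 (hy.eq_of_length_le h.1.length_le)
  | some x => exact .inl hy

lemma forestPart_inter {s : List Y} (l l' : Option Y) (y : M) (hl : l ≠ l')
    (h : y ∈ forestPart f s l) (h' : y ∈ forestPart f s l') : y ∈ {y | f y <+: s} := by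
  by_contra hy
  have hno : ∀ x, y ∈ forestPart f s (some x) → s <+: f y ∧ f y ≠ s := by
    rintro x (hx | hx)
    · exact (hy hx).elim
    · exact ⟨(List.prefix_append _ _).trans hx, fun h => not_prefix_of_concat_prefix hx (h ▸ List.prefix_rfl)⟩
  have : s <+: f y ∧ f y ≠ s := by
    cases l with
    | none =>
      cases l' with
      | none => exact (hl rfl).elim
      | some x => exact hno x h'
    | some x => exact hno x h
  rw [mem_forestPart_iff this.1 this.2] at h h'
  exact hl (h.trans h'.symm)

lemma forestPart_of_prefix {s : List Y} {y z : M} (hyz : f y <+: f z) {l : Option Y}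
    (hz : z ∈ forestPart f s l) : y ∈ forestPart f s l := by
  cases l with
  | none =>
    rintro ⟨h, h'⟩
    refine hz ⟨h.trans hyz, fun hs => h' ?_⟩
    rw [hs] at hyz
    exact hyz.eq_of_length_le h.length_le
  | some x =>
    rcases hz with hz | hz
    · exact .inl (hyz.trans hz)
    · rcases List.prefix_or_prefix_of_prefix hyz hz with h | h
      · rcases List.prefix_concat_iff.1 h with h | h
        · exact .inr (h ▸ List.prefix_rfl)
        · exact .inl h
      · exact .inr h

/-- The components of a related tuple form a chain in the forest, and parts are closed under
ancestors, so a part containing the deepest component contains all of them. -/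
lemma exists_forestPart_of_relMap
    (hcomp : ∀ (k : ℕ) (R : L.Relations k) (a : Fin k → M), RelMap R a →
      ∀ i j, f (a i) <+: f (a j) ∨ f (a j) <+: f (a i))
    (s : List Y) (k : ℕ) (R : L.Relations k) (a : Fin k → M) (h : RelMap R a) :
    ∃ l, ∀ j, a j ∈ forestPart f s l := by
  rcases isEmpty_or_nonempty (Fin k) with hk | hk
  · exact ⟨none, fun j => hk.elim j⟩
  · obtain ⟨i, hi⟩ := Finite.exists_max fun i => (f (a i)).length
    obtain ⟨l, hl⟩ := exists_mem_forestPart (f := f) s (a i)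
    refine ⟨l, fun j => forestPart_of_prefix ?_ hl⟩
    rcases hcomp k R a h i j with h | h
    · rw [h.eq_of_length_le (hi j)]
    · exact h

variable {d k : ℕ} (g : M → Fin k)

variable (f) in
/-- Names for the elements above a node `s`. -/
def apexConst (s : List Y) (t : Fin (d + 1) × Fin k) : Set M :=
  {y | f y = s.take t.1 ∧ g y = t.2}

/-- The colours of the elements. -/
abbrev ForestColour (L : FirstOrder.Language.{0, 0}) (d k r : ℕ) : Type :=
  Option (RankType L (Fin (d + 1) × Fin k) r 2 × RankType L (Fin (d + 1) × Fin k) r 2)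

/-- The relation defined by `φ` between different parts depends only on colours. -/
lemma realize_iff_of_colour (hlen : ∀ y, (f y).length ≤ d)
    (hinj : ∀ y z, f y = f z → g y = g z → y = z)
    (hcomp : ∀ (k : ℕ) (R : L.Relations k) (a : Fin k → M), RelMap R a →
      ∀ i j, f (a i) <+: f (a j) ∨ f (a j) <+: f (a i))
    (φ : MSO L 2) (s : List Y) {x x' y y' : M}
    (hx : s <+: f x ∧ f x ≠ s) (hx' : s <+: f x' ∧ f x' ≠ s)
    (hy : s <+: f y ∧ f y ≠ s) (hy' : s <+: f y' ∧ f y' ≠ s)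
    (hxy : partOf f s x ≠ partOf f s y) (hxy' : partOf f s x' ≠ partOf f s y')
    (h₁ : rankType L (apexConst (d := d) f g s) (forestPart f s (partOf f s x)) φ.rank ![{x}, ∅] =
      rankType L (apexConst f g s) (forestPart f s (partOf f s x')) φ.rank ![{x'}, ∅])
    (h₁' : rankType L (apexConst (d := d) f g s) (forestPart f s (partOf f s x)) φ.rank ![∅, ∅] =
      rankType L (apexConst f g s) (forestPart f s (partOf f s x')) φ.rank ![∅, ∅])
    (h₂ : rankType L (apexConst (d := d) f g s) (forestPart f s (partOf f s y)) φ.rank ![∅, {y}] =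
      rankType L (apexConst f g s) (forestPart f s (partOf f s y')) φ.rank ![∅, {y'}])
    (h₂' : rankType L (apexConst (d := d) f g s) (forestPart f s (partOf f s y)) φ.rank ![∅, ∅] =
      rankType L (apexConst f g s) (forestPart f s (partOf f s y')) φ.rank ![∅, ∅]) :
    φ.Realize ![{x}, {y}] ↔ φ.Realize ![{x'}, {y'}] := by
  refine realize_iff_of_rankType_eq (c := apexConst (d := d) f g s) φ le_rfl ?_
  refine rankType_pair_eq {y | f y <+: s} (forestPart f s) (exists_mem_forestPart s)
    (exists_forestPart_of_relMap hcomp s) (apex_subset_forestPart s) forestPart_inter ?_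
    (mem_forestPart_iff hx.1 hx.2) (mem_forestPart_iff hx'.1 hx'.2)
    (mem_forestPart_iff hy.1 hy.2) (mem_forestPart_iff hy'.1 hy'.2) hxy hxy' h₁ h₁' h₂ h₂'
  intro a ha
  -- A point above `s` is named by its level and its value under `g`, which separates the points at
  -- one forest node.
  refine ⟨(⟨(f a).length, Nat.lt_succ_of_le (hlen a)⟩, g a), Set.eq_singleton_iff_unique_mem.2
    ⟨⟨List.prefix_iff_eq_take.1 ha, rfl⟩, ?_⟩⟩
  rintro b ⟨hb, hb'⟩
  exact hinj _ _ (hb.trans (List.prefix_iff_eq_take.1 ha).symm) hb'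

/-- On the fibre of `f` over `s` the map `g` is injective, so at most `k` points sit at the node
`s`, and each of them accounts for at most one `j`. -/
lemma card_le_of_fiber {m : ℕ} (hinj : ∀ y z, f y = f z → g y = g z → y = z) (s : List Y)
    (R : Fin m → M → Prop) (hR : ∀ j j' y, R j y → R j' y → j = j')
    (T : Finset (Fin m)) (hT : ∀ j ∈ T, ∃ y, f y = s ∧ R j y) : T.card ≤ k := by
  rcases T.eq_empty_or_nonempty with rfl | ⟨j₀, hj₀⟩
  · simp
  have : Nonempty M := ⟨(hT j₀ hj₀).choose⟩
  choose! y hy hRy using hT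
  have h := Finset.card_le_card_of_injOn (s := T) (t := (Finset.univ : Finset (Fin k)))
    (fun j => g (y j)) (by simp) fun j hj j' hj' h => hR _ _ _ (hRy j hj) (by
      rw [hinj _ _ ((hy j hj).trans (hy j' hj').symm) h]
      exact hRy j' hj')
  simpa using h

open Classical in
/-- Descending to a child of `s` makes the height of the tree drop by at most one. -/
lemma IsTreeBelow.step [Finite (Σ k, L.Relations k)] (hlen : ∀ y, (f y).length ≤ d)
    (hinj : ∀ y z, f y = f z → g y = g z → y = z)
    (hcomp : ∀ (k : ℕ) (R : L.Relations k) (a : Fin k → M), RelMap R a →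
      ∀ i j, f (a i) <+: f (a j) ∨ f (a j) <+: f (a i))
    (φ : MSO L 2) {s : List Y} {m h : ℕ}
    (hm : Nat.card (ForestColour L d k φ.rank × ForestColour L d k φ.rank) * 4 + k + k < m)
    {gV : List (Fin m) → M} {gE : List (Fin m) → Fin m → M} (hh : 1 ≤ h)
    (hT : IsTreeBelow (fun x y => φ.Realize ![{x}, {y}]) f s m (h + 1) gV gE) :
    ∃ (x : Y) (j : Fin m), IsTreeBelow (fun x y => φ.Realize ![{x}, {y}]) f (s ++ [x]) m h
      (fun u => gV (j :: u)) (fun u d => gE (j :: u) d) := by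
  have := finite_rankType (L := L) (ι := Fin (d + 1) × Fin k) φ.rank 2
  let ty : M → (Fin 2 → Set M) → RankType L (Fin (d + 1) × Fin k) φ.rank 2 := fun y V =>
    rankType L (apexConst (d := d) f g s) (forestPart f s (partOf f s y)) φ.rank V
  let okV : List (Fin m) → Prop := fun u => u.length < h + 1 ∧ f (gV u) ≠ s
  let okE : List (Fin m) × Fin m → Prop := fun e => e.1.length + 1 < h + 1 ∧ f (gE e.1 e.2) ≠ s
  let ca : List (Fin m) → ForestColour L d k φ.rank := fun u =>
    if okV u then some (ty (gV u) ![{gV u}, ∅], ty (gV u) ![∅, ∅]) else none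
  let cb : List (Fin m) × Fin m → ForestColour L d k φ.rank := fun e =>
    if okE e then some (ty (gE e.1 e.2) ![∅, {gE e.1 e.2}], ty (gE e.1 e.2) ![∅, ∅]) else none
  -- Nodes are played against tree edges `(u, d)`, whose only neighbours are `u` and `u ++ [d]`.
  -- Points not strictly below `s` get the colour `none` and are excluded from the relation.
  obtain ⟨S, hS, hcov⟩ := exists_cover
    (fun u e => okV u ∧ okE e ∧ φ.Realize ![{gV u}, {gE e.1 e.2}])
    (fun e => {e.1, e.1 ++ [e.2]}) (fun e => Finset.card_le_two)
    (fun u e ⟨hu, he, hE⟩ => by simpa using (hT.inc _ _ _ hu.1 he.1).1 hE)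
    (fun u => partOf f s (gV u)) (fun e => partOf f s (gE e.1 e.2)) ca cb (by
      rintro u e u' e' hp hp' hc hc' ⟨hu, he, hE⟩
      have hu' : okV u' := by
        by_contra hu'
        simp [ca, hu, hu'] at hc
      have he' : okE e' := by
        by_contra he'
        simp [cb, he, he'] at hc'
      simp only [ca, cb, hu, hu', he, he', if_true, Option.some.injEq, Prod.mk.injEq] at hc hc'
      exact ⟨hu', he', (realize_iff_of_colour g hlen hinj hcomp φ s
        ⟨hT.prefV _ hu.1, hu.2⟩ ⟨hT.prefV _ hu'.1, hu'.2⟩ ⟨hT.prefE _ _ he.1, he.2⟩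
        ⟨hT.prefE _ _ he'.1, he'.2⟩ hp hp' hc.1 hc.2 hc'.1 hc'.2).1 hE⟩)
  -- A child `j` of the root is bad if its subtree meets the exceptional set `S` (`T₁`), or has a
  -- node (`T₂`) or an edge (`T₃`) placed at `s` itself. The bound `hm` leaves a good `j`.
  let T₁ : Finset (Fin m) := S.biUnion fun u => u.head?.toFinset
  let RV : Fin m → M → Prop := fun j y => ∃ u, u.length + 1 < h + 1 ∧ y = gV (j :: u)
  let RE : Fin m → M → Prop := fun j y => ∃ u e, u.length + 1 + 1 < h + 1 ∧ y = gE (j :: u) e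
  let T₂ : Finset (Fin m) := {j | ∃ y, f y = s ∧ RV j y}
  let T₃ : Finset (Fin m) := {j | ∃ y, f y = s ∧ RE j y}
  have hT₁ : T₁.card ≤ S.card := by
    simpa using Finset.card_biUnion_le_card_mul S (fun u => u.head?.toFinset) 1
      (fun u _ => by cases u <;> simp)
  have hT₂ : T₂.card ≤ k := card_le_of_fiber g hinj s RV (by
    rintro j j' y ⟨u, hu, rfl⟩ ⟨u', hu', h'⟩
    exact (List.cons.inj (hT.injV _ _ (by simpa using hu) (by simpa using hu') h')).1) T₂
      fun j hj => (Finset.mem_filter.1 hj).2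
  have hT₃ : T₃.card ≤ k := card_le_of_fiber g hinj s RE (by
    rintro j j' y ⟨u, e, hu, rfl⟩ ⟨u', e', hu', h'⟩
    exact (List.cons.inj (hT.injE _ _ _ _ (by simpa using hu) (by simpa using hu') h')).1) T₃
      fun j hj => (Finset.mem_filter.1 hj).2
  obtain ⟨j, hj⟩ : ∃ j, j ∉ T₁ ∪ T₂ ∪ T₃ := by
    by_contra! hall
    have h₁ := Finset.card_le_card (fun j _ => hall j : Finset.univ ⊆ T₁ ∪ T₂ ∪ T₃)
    have h₂ := Finset.card_union_le (T₁ ∪ T₂) T₃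
    have h₃ := Finset.card_union_le T₁ T₂
    rw [Finset.card_univ, Fintype.card_fin] at h₁
    omega
  simp only [Finset.mem_union, not_or] at hj
  obtain ⟨⟨hj₁, hj₂⟩, hj₃⟩ := hj
  have hokV : ∀ u : List (Fin m), u.length < h → okV (j :: u) := fun u hu =>
    ⟨by simpa using hu, fun hs => hj₂ (Finset.mem_filter.2
      ⟨Finset.mem_univ _, _, hs, u, by omega, rfl⟩)⟩
  have hokE : ∀ (u : List (Fin m)) e, u.length + 1 < h → okE (j :: u, e) := fun u e hu =>
    ⟨by simpa using hu, fun hs => hj₃ (Finset.mem_filter.2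
      ⟨Finset.mem_univ _, _, hs, u, e, by omega, rfl⟩)⟩
  have hnS : ∀ u, j :: u ∉ S := fun u hu =>
    hj₁ (Finset.mem_biUnion.2 ⟨_, hu, by simp⟩)
  have hedge : ∀ (v u : List (Fin m)) e, v.length < h → u.length + 1 < h → v = u ∨ v = u ++ [e] →
      partOf f s (gV (j :: v)) = partOf f s (gE (j :: u) e) := by
    intro v u e hv hu hvu
    refine (hcov (j :: v) (j :: u, e) ⟨hokV v hv, hokE u e hu, ?_⟩).resolve_right (hnS v)
    exact (hT.inc _ _ _ (hokV v hv).1 (hokE u e hu).1).2 (by simpa using hvu)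
  -- By `hedge`, incident points below a good `j` share their part. As the subtree is connected, the
  -- part of its root propagates to all of it.
  obtain ⟨x, hx, -⟩ := partOf_eq_some (hT.prefV [j] (hokV [] hh).1) (hokV [] hh).2
  have hpV : ∀ u : List (Fin m), u.length < h → partOf f s (gV (j :: u)) = some x := by
    intro u
    induction u using List.reverseRecOn with
    | nil => exact fun _ => hx
    | append_singleton u e ih =>
      intro hu
      have hu' : u.length + 1 < h := by simpa using hu
      rw [hedge (u ++ [e]) u e hu hu' (.inr rfl), ← hedge u u e (by omega) hu' (.inl rfl)]
      exact ih (by omega)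
  have hpE : ∀ (u : List (Fin m)) e, u.length + 1 < h → partOf f s (gE (j :: u) e) = some x :=
    fun u e hu => by
      rw [← hedge u u e (by omega) hu (.inl rfl)]
      exact hpV u (by omega)
  refine ⟨x, j, fun u hu => ?_, fun u e hu => ?_, fun u v hu hv h' => ?_,
    fun u e u' e' hu hu' h' => ?_, fun v u e hv hu => ?_⟩
  · obtain ⟨z, hz, hz'⟩ := partOf_eq_some (hT.prefV _ (hokV u hu).1) (hokV u hu).2
    rwa [Option.some.inj ((hpV u hu).symm.trans hz)]
  · obtain ⟨z, hz, hz'⟩ := partOf_eq_some (hT.prefE _ _ (hokE u e hu).1) (hokE u e hu).2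
    rwa [Option.some.inj ((hpE u e hu).symm.trans hz)]
  · exact (List.cons.inj (hT.injV _ _ (hokV u hu).1 (hokV v hv).1 h')).2
  · exact (List.cons.inj (hT.injE _ _ _ _ (hokE u e hu).1 (hokE u' e' hu').1 h')).2
  · simpa using hT.inc (j :: v) (j :: u) e (hokV v hv).1 (hokE u e hu).1

/-- A structure with a forest of height `d` does not contain definable trees of height `d + 2` and
large degree. -/
theorem not_isTreeBelow [Finite (Σ k, L.Relations k)] (hlen : ∀ y, (f y).length ≤ d)
    (hinj : ∀ y z, f y = f z → g y = g z → y = z)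
    (hcomp : ∀ (k : ℕ) (R : L.Relations k) (a : Fin k → M), RelMap R a →
      ∀ i j, f (a i) <+: f (a j) ∨ f (a j) <+: f (a i))
    (φ : MSO L 2) {m : ℕ}
    (hm : Nat.card (ForestColour L d k φ.rank × ForestColour L d k φ.rank) * 4 + k + k < m)
    (h : ℕ) : ∀ {s : List Y}, d + 1 ≤ s.length + h → ∀ {gV : List (Fin m) → M}
    {gE : List (Fin m) → Fin m → M},
    ¬ IsTreeBelow (fun x y => φ.Realize ![{x}, {y}]) f s m (h + 1) gV gE := by
  induction h with
  | zero =>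
    intro s hs gV gE hT
    -- Now `s` has length at least `d + 1`, but the root of the tree is placed at or below `s`, at a
    -- level of at most `d`.
    have h₁ := (hT.prefV [] (by simp)).length_le
    have h₂ := hlen (gV [])
    omega
  | succ h ih =>
    intro s hs gV gE hT
    obtain ⟨x, j, hT'⟩ := hT.step g hlen hinj hcomp φ hm (by omega)
    exact ih (by simp only [List.length_append, List.length_singleton]; omega) hT'

end

/-! ### Trees are not images of structures of bounded tree-depth -/

section

instance finite_sigma_incRel {L : FirstOrder.Language.{0, 0}} [L.IsRelational] [Finite L.Symbols] :
    Finite (Σ n, (incLang L).Relations n) := by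
  have := finite_sigma_relations (L := L)
  refine Finite.of_surjective (fun x : (Σ n, L.Relations n) ⊕ Position L => match x with
    | .inl R => (⟨1, IncRel.P R.2⟩ : Σ n, (incLang L).Relations n)
    | .inr p => ⟨2, IncRel.inc p.1 p.2⟩) ?_
  rintro ⟨_, ⟨R⟩ | ⟨p, hp⟩⟩
  · exact ⟨.inl ⟨_, R⟩, rfl⟩
  · exact ⟨.inr ⟨p, hp⟩, rfl⟩

instance finite_sigma_expRel {L : FirstOrder.Language.{0, 0}} {m : ℕ}
    [Finite (Σ n, L.Relations n)] : Finite (Σ n, (expLang L m).Relations n) := by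
  refine Finite.of_surjective (fun x : (Σ n, L.Relations n) ⊕ Fin m => match x with
    | .inl R => (⟨_, .inl R.2⟩ : Σ n, (expLang L m).Relations n)
    | .inr i => ⟨1, .inr (.param i)⟩) ?_
  rintro ⟨n, R | R⟩
  · exact ⟨.inl ⟨n, R⟩, rfl⟩
  · cases R with
    | param i => exact ⟨.inr i, rfl⟩

instance finite_sigma_copyRel {L : FirstOrder.Language.{0, 0}} {k : ℕ}
    [Finite (Σ n, L.Relations n)] : Finite (Σ n, (copyLang L k).Relations n) := by
  by_cases hk : 2 ≤ k
  · refine Finite.of_surjective (fun x : (Σ n, L.Relations n) ⊕ Option (Fin k) => match x with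
      | .inl R => (⟨_, .inl R.2⟩ : Σ n, (copyLang L k).Relations n)
      | .inr none => ⟨2, .inr (.sim hk)⟩
      | .inr (some i) => ⟨1, .inr (.part hk i)⟩) ?_
    rintro ⟨n, R | ⟨h⟩ | ⟨h, i⟩⟩
    · exact ⟨.inl ⟨n, R⟩, rfl⟩
    · exact ⟨.inr none, rfl⟩
    · exact ⟨.inr (some i), rfl⟩
  · refine Finite.of_surjective (fun R : (Σ n, L.Relations n) =>
      (⟨_, .inl R.2⟩ : Σ n, (copyLang L k).Relations n)) ?_
    rintro ⟨n, R | ⟨h⟩ | ⟨h, i⟩⟩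
    · exact ⟨⟨n, R⟩, rfl⟩
    · exact (hk h).elim
    · exact (hk h).elim

variable {L : FirstOrder.Language.{0, 0}} [L.IsRelational] [Finite L.Symbols]

/-- Points that are related in a copy of an expansion lie on a common branch. -/
lemma comparable_of_relMap_copy {A : FinStr L} {Y : Type} {f : A.incidence.carrier → List Y}
    (hadj : ∀ x y, A.IncAdj x y → f x <+: f y ∨ f y <+: f x) {m k : ℕ}
    (Q : Fin m → Set A.incidence.carrier) {n : ℕ}
    (R : (copyLang (expLang (incLang L) m) k).Relations n)
    (a : Fin n → A.incidence.carrier × Fin k)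
    (h : RelMap (M := ((A.incidence.exp Q).copy k).carrier) R a) (i j : Fin n) :
    f (a i).1 <+: f (a j).1 ∨ f (a j).1 <+: f (a i).1 := by
  have hone : ∀ (a : Fin 1 → A.incidence.carrier × Fin k) (i j : Fin 1),
      f (a i).1 <+: f (a j).1 ∨ f (a j).1 <+: f (a i).1 := fun a i j => by
    rw [Subsingleton.elim i j]
    exact .inl List.prefix_rfl
  have htwo : ∀ (a : Fin 2 → A.incidence.carrier × Fin k),
      (f (a 0).1 <+: f (a 1).1 ∨ f (a 1).1 <+: f (a 0).1) → ∀ i j,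
      f (a i).1 <+: f (a j).1 ∨ f (a j).1 <+: f (a i).1 := fun a h i j => by
    fin_cases i <;> fin_cases j
    · exact .inl List.prefix_rfl
    · exact h
    · exact h.symm
    · exact .inl List.prefix_rfl
  rcases R with (⟨⟨R⟩ | ⟨p, hp⟩⟩ | ⟨⟨q⟩⟩) | (⟨h₂⟩ | ⟨h₂, c⟩)
  · exact hone a i j
  · obtain ⟨c, -, h⟩ := h
    exact htwo a (hadj _ _ ⟨p, .inl h⟩) i j
  · exact hone a i j
  · have h : (a 0).1 = (a 1).1 := h
    exact htwo a (.inl (by rw [h])) i j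
  · exact hone a i j

/-- The incidence formulae of a transduction would define a tree of height `d + 2` inside a copied
expansion. Copying and colouring keep the forest usable: twins share a node, new relations join only
comparable points, and at most `τ.k` points sit at each node. -/
theorem not_treeClass_belowIn (C : Set (FinStr L)) (d : ℕ)
    (h : ∀ A ∈ C, ∀ p : List A.incidence.carrier, IsSimplePath A.IncAdj p → p.length ≤ d) :
    ¬ BelowIn (treeClass (d + 2)) C := by
  rintro ⟨τ, hτ⟩
  let φ : MSO (copyLang (expLang (incLang L) τ.m) τ.k) 2 :=
    .or (τ.base.φ (incSym zero_position_graph)) (τ.base.φ (incSym one_position_graph))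
  -- One more than the bound in `not_isTreeBelow`. It depends only on `L`, `d` and `τ`, so the tree
  -- can be fixed before its preimage `A` is known.
  let m := Nat.card (ForestColour (copyLang (expLang (incLang L) τ.m) τ.k) d τ.k φ.rank ×
    ForestColour (copyLang (expLang (incLang L) τ.m) τ.k) d τ.k φ.rank) * 4 + τ.k + τ.k + 1
  obtain ⟨_, ⟨A, hA, rfl⟩, Q, -, ⟨e⟩⟩ := hτ ⟨_, ⟨m, rfl⟩, rfl⟩
  obtain ⟨f, hf, hlast, hadj⟩ := exists_normal_forest A.IncAdj fun _ _ => FinStr.IncAdj.symm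
  have hfinj : Function.Injective f := fun x y hxy => by
    have := hlast x
    rw [hxy, hlast y] at this
    exact (Option.some.inj this).symm
  let T := {x : List (Fin m) // x.length < d + 2}
  let pt : (digraph T (treeEdge m (d + 2))).incidence.carrier → A.incidence.carrier × Fin τ.k :=
    fun x => (e x).1
  have hpt : Function.Injective pt := fun x y h => e.injective (Subtype.ext h)
  have hrel : ∀ x y z, z = pt y → (MSO.Realize (A := ((A.incidence.exp Q).copy τ.k).carrier) φ
      ![{pt x}, {z}] ↔ (digraph T (treeEdge m (d + 2))).IncAt 0 x y ∨
        (digraph T (treeEdge m (d + 2))).IncAt 1 x y) := by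
    rintro x y _ rfl
    refine (MSO.realize_or (A := ((A.incidence.exp Q).copy τ.k).carrier) _ _ _).trans ?_
    have hV : (![{pt x}, {pt y}] : Fin 2 → Set (A.incidence.carrier × Fin τ.k)) =
        fun i => {pt (![x, y] i)} := by
      funext i; fin_cases i <;> rfl
    have hV' : ∀ ψ : MSO (copyLang (expLang (incLang L) τ.m) τ.k) 2, MSO.Realize (A := ((A.incidence.exp Q).copy τ.k).carrier) ψ
        ![{pt x}, {pt y}] ↔ MSO.RealizeAt (A := ((A.incidence.exp Q).copy τ.k).carrier) ψ
          fun i => pt (![x, y] i) :=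
      fun ψ => iff_of_eq (congrArg
        (MSO.Realize (A := ((A.incidence.exp Q).copy τ.k).carrier) ψ) hV)
    exact or_congr ((hV' _).trans (e.map_rel' (incSym zero_position_graph) ![x, y]))
      ((hV' _).trans (e.map_rel' (incSym one_position_graph) ![x, y]))
  let root : T := ⟨[], by simp⟩
  -- Lists that are too long go to the root; `IsTreeBelow` never inspects them. The same holds for
  -- the default value of `gE`.
  let node : List (Fin m) → T := fun u => if hu : u.length < d + 2 then ⟨u, hu⟩ else root
  have hnode : ∀ u (hu : u.length < d + 2), node u = ⟨u, hu⟩ := fun u hu => dif_pos hu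
  have hedge : ∀ (u : List (Fin m)) (c : Fin m) (hu : u.length + 1 < d + 2),
      treeEdge m (d + 2) (node u) (node (u ++ [c])) := by
    intro u c hu
    rw [hnode u (by omega), hnode (u ++ [c]) (by simpa using hu)]
    exact ⟨c, rfl⟩
  let gE : List (Fin m) → Fin m → A.incidence.carrier × Fin τ.k := fun u c =>
    if hu : u.length + 1 < d + 2 then pt (edgePoint (hedge u c hu)) else pt (vertexPoint _ root)
  have hgE : ∀ u c (hu : u.length + 1 < d + 2), gE u c = pt (edgePoint (hedge u c hu)) :=
    fun u c hu => dif_pos hu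
  refine not_isTreeBelow (L := copyLang (expLang (incLang L) τ.m) τ.k)
    (M := ((A.incidence.exp Q).copy τ.k).carrier)
    (f := fun y : A.incidence.carrier × Fin τ.k => f y.1) (d := d)
    (fun y : A.incidence.carrier × Fin τ.k => y.2)
    (fun y => h A hA _ (hf y.1)) (fun y z h₁ h₂ => Prod.ext (hfinj h₁) h₂)
    (fun n R a hR => comparable_of_relMap_copy hadj Q R a hR) φ (m := m) (Nat.lt_succ_self _)
    (d + 1) (s := []) (by simp) (gV := fun u => pt (vertexPoint _ (node u)))
    (gE := gE) ?_
  constructor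
  · exact fun _ _ => List.nil_prefix
  · exact fun _ _ _ => List.nil_prefix
  · intro u v hu hv huv
    have := vertexPoint_inj.1 (hpt huv)
    rw [hnode u hu, hnode v hv] at this
    exact congrArg Subtype.val this
  · intro u c u' c' hu hu' huv
    have := (edgePoint_inj.1 (hpt ((hgE u c hu).symm.trans (huv.trans (hgE u' c' hu'))))).1
    rw [hnode u (by omega), hnode u' (by omega)] at this
    exact congrArg Subtype.val this
  · intro v u c hv hu
    refine (hrel _ _ _ (hgE u c hu)).trans ?_
    rw [incAt_zero_iff, incAt_one_iff]
    have hu' : (u ++ [c]).length < d + 2 := by simpa using hu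
    constructor
    · rintro (⟨x, y, hxy, hx, hy⟩ | ⟨x, y, hxy, hx, hy⟩)
      · have h₁ := (vertexPoint_inj.1 hx).trans (edgePoint_inj.1 hy).1.symm
        rw [hnode v hv, hnode u (by omega)] at h₁
        exact .inl (congrArg Subtype.val h₁)
      · have h₁ := (vertexPoint_inj.1 hx).trans (edgePoint_inj.1 hy).2.symm
        rw [hnode v hv, hnode _ hu'] at h₁
        exact .inr (congrArg Subtype.val h₁)
    · rintro (rfl | rfl)
      · exact .inl ⟨_, _, hedge v c hu, rfl, rfl⟩
      · exact .inr ⟨_, _, hedge u c hu, rfl, rfl⟩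

end

end MSOTransduction

/-! ### The dichotomy between unbounded and bounded path length -/

theorem mainTheorem9 (L : FirstOrder.Language.{0, 0}) [L.IsRelational] [Finite L.Symbols]
    (C : Set (MSOTransduction.FinStr L)) :
    ((∀ n : ℕ, MSOTransduction.BelowIn (MSOTransduction.treeClass n) C) →
      MSOTransduction.BelowIn MSOTransduction.pathClass C) ∧
    (MSOTransduction.StrictlyBelowIn C MSOTransduction.pathClass →
      ∃ n : ℕ, MSOTransduction.BelowIn C (MSOTransduction.treeClass n)) := by
  by_cases h : ∀ d : ℕ, ∃ A ∈ C, ∃ p : List A.incidence.carrier,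
      MSOTransduction.IsSimplePath A.IncAdj p ∧ d ≤ p.length
  · have h' := MSOTransduction.pathClass_belowIn C h
    exact ⟨fun _ => h', fun hC => (hC.2 h').elim⟩
  · push Not at h
    obtain ⟨d, hd⟩ := h
    have hd' : ∀ A ∈ C, ∀ p : List A.incidence.carrier,
        MSOTransduction.IsSimplePath A.IncAdj p → p.length ≤ d := fun A hA p hp => (hd A hA p hp).le
    exact ⟨fun hT => (MSOTransduction.not_treeClass_belowIn C d hd' (hT _)).elim,
      fun _ => ⟨_, MSOTransduction.belowIn_treeClass C d hd'⟩⟩
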